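/- Let $k$ be a field and let $m,n\ge 1$ be integers. Put $l=m+n-1$. Notation. For $a\ge1$, $\overrightarrow{\mathbb A}_a$ is the quiver $1\to2\to\dots\to a$; products of such quivers and of their opposites carry all commutation relations, and modules over them are finite-dimensional $k$-linear representations (finite-dimensional right modules over the path algebra with these relations). $D\mathcal A_a$ and $D\mathcal A_{a,b}$ are the bounded derived categories of modules over $\overrightarrow{\mathbb A}_a$ and $\overrightarrow{\mathbb A}_a\times\overrightarrow{\mathbb A}_b$, $S$ is the shift functor, and $X$ is the flip equivalence exchanging two factors. The standard module with support $\mathsf S$ is $k$ at the vertices of $\mathsf S$ and $0$ elsewhere, with identity maps between vertices of $\mathsf S$. For $1\le i\le m$ let $\mathsf S_{m;i}^n\subset[1,m+n-1]\times[1,m]\times[1,n]$ be the set of triples $(\gamma,\mu,\nu)$ such that $$(\mu\le i-1,\ \gamma\le\mu)\ \text{ or }\ (\mu=i,\ \gamma\le i+\nu-1)\ \text{ or }\ (\mu\ge i+1,\ \gamma\le\mu+n-1),$$ let $M_{m;i}^n$ be the standard $\overrightarrow{\mathbb A}_{m+n-1}^{op}\times\overrightarrow{\mathbb A}_m\times\overrightarrow{\mathbb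 A}_n$-module with support $\mathsf S_{m;i}^n$, and let $\nabla_{m;i}^n={?}\otimes^L_{\overrightarrow{\mathbb A}_{m+n-1}}M_{m;i}^n: D\mathcal A_{m+n-1}\to D\mathcal A_{m,n}$. Let $N_a$ be the standard $\overrightarrow{\mathbb A}_a^{op}\times\overrightarrow{\mathbb A}_a$-module with support $\{(i,j)\mid i\ge j\}$. The Nakayama functor $\nu_a$ is the left derived functor of the tensor product with the $k$-dual of the path algebra of $\overrightarrow{\mathbb A}_a$, and $\tau_a=S^{-1}\nu_a$ is the Auslander–Reiten translation. On $D\mathcal A_{a,b}$, $\tau_a\times\tau_b$ is the composite of $\tau_a\times\mathrm{Id}$ and $\mathrm{Id}\times\tau_b$, obtained by applying these constructions in one factor at a time. A subset of a box $[1,d_1]\times\dots\times[1,d_r]$ is projective (resp. injective) in a direction of length $d$ if its fibers in this direction are stable under increasing (resp. decreasing) the coordinate. Its fiber-reversal in this direction is obtained by replacing every nonempty fiber $[a,d]$ by $[1,a]$ (resp. every nonempty fiber $[1,a]$ by $[a,d]$); empty fibers stay empty. Then the following hold. 1. $\mathsf S_{m;1}^n$ is injective in the direction of length $l$ (its first coordinate),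 $\mathsf S_{n;n}^m\subset[1,l]\times[1,n]\times[1,m]$ is projective in the direction of length $m$ (its third coordinate), and the fiber-reversal of $\mathsf S_{n;n}^m$ in that direction is projective in the direction of length $n$ (its second coordinate). Up to the exchange of the factors $[1,m]$ and $[1,n]$, the fiber-reversal of $\mathsf S_{m;1}^n$ in the direction of length $l$ is equal to the fiber-reversal, in the direction of length $n$, of the fiber-reversal, in the direction of length $m$, of $\mathsf S_{n;n}^m$. 2. The derived functors below exist on the bounded derived categories, and in the bounded derived category of $\overrightarrow{\mathbb A}_l^{op}\times\overrightarrow{\mathbb A}_m\times\overrightarrow{\mathbb A}_n$-modules there is, up to the flip of the factors $\overrightarrow{\mathbb A}_m$ and $\overrightarrow{\mathbb A}_n$, an isomorphism $$N_{l}\otimes^L_{\overrightarrow{\mathbb A}_{l}}M_{m;1}^n\;\simeq\;(M_{n;n}^m\otimes^L_{\overrightarrow{\mathbb A}_m}N_m)\otimes^L_{\overrightarrow{\mathbb A}_n}N_n .$$ 3. There is a natural isomorphism of functors from $D\mathcal A_{l}$ to $D\mathcal A_{m,n}$ $$\nabla_{m;1}^n\,\tau_{l}\;\simeq\;S\,X\,(\tau_n\times\tau_m)\,\nabla_{n;n}^m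 .$$ -/

import Mathlib

open CategoryTheory CategoryTheory.Limits MonoidalCategory Opposite

universe u v w

attribute [local instance] HasDerivedCategory.standard

namespace TypeA

/-! ### Supports and fiber-reversals -/

/-- The integer box `[1, d i₁] × ⋯ × [1, d iᵣ]`. -/
def box {ι : Type*} (d : ι → ℕ) : Set (ι → ℕ) := {p | ∀ i, 1 ≤ p i ∧ p i ≤ d i}

/-- `S` is projective in the direction `i`: every fiber in this direction is closed under
increasing the `i`-th coordinate inside the box. -/
def ProjectiveInDirection {ι : Type*} [DecidableEq ι] (d : ι → ℕ) (i : ι)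
    (S : Set (ι → ℕ)) : Prop :=
  S ⊆ box d ∧ ∀ p ∈ S, ∀ l, p i ≤ l → l ≤ d i → Function.update p i l ∈ S

/-- `S` is injective in the direction `i`: every fiber in this direction is closed under
decreasing the `i`-th coordinate inside the box. -/
def InjectiveInDirection {ι : Type*} [DecidableEq ι] (d : ι → ℕ) (i : ι)
    (S : Set (ι → ℕ)) : Prop :=
  S ⊆ box d ∧ ∀ p ∈ S, ∀ l, 1 ≤ l → l ≤ p i → Function.update p i l ∈ S

/-- Fiber-reversal in the direction `i` of a set which is projective in this direction: a nonempty
fiber `[a, d i]` becomes `[1, a]`, and an empty fiber stays empty. -/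
def reverseProjective {ι : Type*} [DecidableEq ι] (d : ι → ℕ) (i : ι)
    (S : Set (ι → ℕ)) : Set (ι → ℕ) :=
  {p | p ∈ box d ∧ (∃ l, Function.update p i l ∈ S) ∧ Function.update p i (p i - 1) ∉ S}

/-- Fiber-reversal in the direction `i` of a set which is injective in this direction: a nonempty
fiber `[1, a]` becomes `[a, d i]`, and an empty fiber stays empty. -/
def reverseInjective {ι : Type*} [DecidableEq ι] (d : ι → ℕ) (i : ι)
    (S : Set (ι → ℕ)) : Set (ι → ℕ) :=
  {p | p ∈ box d ∧ (∃ l, Function.update p i l ∈ S) ∧ Function.update p i (p i + 1) ∉ S}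

/-- The side lengths `(m + n - 1, m, n)`. -/
def sides (m n : ℕ) : Fin 3 → ℕ := ![m + n - 1, m, n]

/-- The set `S_{m;i}^n` of triples `(γ, μ, ν)` in `[1, m+n-1] × [1, m] × [1, n]`. -/
def supportSet (m i n : ℕ) : Set (Fin 3 → ℕ) :=
  {p | p ∈ box (sides m n) ∧
    ((p 1 ≤ i - 1 ∧ p 0 ≤ p 1) ∨ (p 1 = i ∧ p 0 ≤ i + p 2 - 1) ∨
      (i + 1 ≤ p 1 ∧ p 0 ≤ p 1 + n - 1))}

/-- The exchange of the last two coordinates of a triple. -/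
def swapLast (p : Fin 3 → ℕ) : Fin 3 → ℕ := ![p 0, p 2, p 1]

/-! ### Representations -/

/-- The vertices of the quiver `1 ⟶ 2 ⟶ ⋯ ⟶ n`. As a poset this is the path category of the
quiver, and products of such posets are the path categories of the product quivers with all
commutation relations. -/
abbrev Vtx (n : ℕ) : Type := ↥(Set.Icc 1 n)

/-- Finite-dimensional right modules over (the path algebra of) a quiver with path category `I`:
functors from `I` to finite-dimensional vector spaces. A left module is a module over `Iᵒᵖ`. -/
abbrev Rep (k : Type u) [Field k] (I : Type) [SmallCategory I] := I ⥤ FGModuleCat.{u} k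

/-- `k` if `P` holds, and `0` otherwise. -/
def lineIf (k : Type u) [Field k] (P : Prop) : Submodule k k where
  carrier := {x | ¬ P → x = 0}
  add_mem' ha hb h := by rw [ha h, hb h, add_zero]
  zero_mem' _ := rfl
  smul_mem' c x hx h := by rw [hx h, smul_zero]

/-- The linear map `lineIf k P → lineIf k Q` which is the identity of `k` if `P` and `Q` hold, and
is `0` otherwise. -/
noncomputable def lineIfMap (k : Type u) [Field k] (P Q : Prop) : lineIf k P →ₗ[k] lineIf k Q :=
  open Classical in
  { toFun := fun x => ⟨if Q then x.1 else 0, fun h => by simp [h]⟩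
    map_add' := fun x y => by ext; by_cases h : Q <;> simp [h]
    map_smul' := fun c x => by ext; by_cases h : Q <;> simp [h] }

/-- The standard module with support `S`: it is `k` on `S` and `0` elsewhere, and all maps between
vertices of `S` are identities. The commutation relations force `S` to be convex. -/
noncomputable def standardModule (k : Type u) [Field k] {I : Type} [SmallCategory I] (S : I → Prop)
    (hS : ∀ ⦃a b c : I⦄, (a ⟶ b) → (b ⟶ c) → S a → S c → S b) : Rep k I where
  obj a := FGModuleCat.of k (lineIf k (S a))
  map {a b} _ := FGModuleCat.ofHom (lineIfMap k (S a) (S b))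
  map_id a := by
    classical
    refine FGModuleCat.hom_ext (LinearMap.ext fun (x : lineIf k (S a)) => Subtype.ext ?_)
    change (if S a then x.1 else 0) = x.1
    split_ifs with h
    · rfl
    · exact (x.2 h).symm
  map_comp {a b c} f g := by
    classical
    refine FGModuleCat.hom_ext (LinearMap.ext fun (x : lineIf k (S a)) => Subtype.ext ?_)
    change (if S c then x.1 else 0) = if S c then (if S b then x.1 else 0) else 0
    split_ifs with hc hb
    · rfl
    · exact x.2 fun ha => hb (hS f g ha hc)
    · rfl

/-- The triple of integers of a vertex of `A_l^op × A_m × A_n`. -/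
def triple {l m n : ℕ} (p : (Vtx l)ᵒᵖ × (Vtx m × Vtx n)) : Fin 3 → ℕ :=
  ![p.1.unop.1, p.2.1.1, p.2.2.1]

/-- `S_{m;i}^n` is closed under decreasing `γ` and increasing `μ` and `ν`. -/
lemma supportSet_closed (l m i n : ℕ) (h : l = m + n - 1)
    {p q : (Vtx l)ᵒᵖ × (Vtx m × Vtx n)} (f : p ⟶ q) (hp : triple p ∈ supportSet m i n) :
    triple q ∈ supportSet m i n := by
  subst h
  obtain ⟨⟨⟨c, hc⟩⟩, ⟨b, hb⟩, ⟨a, ha⟩⟩ := p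
  obtain ⟨⟨⟨c', hc'⟩⟩, ⟨b', hb'⟩, ⟨a', ha'⟩⟩ := q
  have h1 : c' ≤ c := leOfHom f.1.unop
  have h2 : b ≤ b' := leOfHom f.2.1
  have h3 : a ≤ a' := leOfHom f.2.2
  rw [Set.mem_Icc] at hc hb ha hc' hb' ha'
  simp only [supportSet, box, sides, triple, Set.mem_ofPred_eq, Fin.forall_fin_succ,
    Matrix.cons_val, Fin.succ_zero_eq_one, Fin.succ_one_eq_two] at hp ⊢
  refine ⟨by simp_all, ?_⟩
  have := hp.2
  lia

/-- The `A_l^op × A_m × A_n`-module `M_{m;i}^n`, where `l = m + n - 1`: the standard module with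
support `S_{m;i}^n`. (The number `l` is a separate argument because `m + n - 1` and `n + m - 1` are
not syntactically equal.) -/
noncomputable def moduleM (k : Type u) [Field k] (l m i n : ℕ) (h : l = m + n - 1) :
    Rep k ((Vtx l)ᵒᵖ × (Vtx m × Vtx n)) :=
  standardModule k (fun p => triple p ∈ supportSet m i n)
    (fun _ _ _ f _ ha _ => supportSet_closed l m i n h f ha)

/-- The `A_n^op × A_n`-module `N_n`: the standard module with support `{(i, j) | i ≥ j}`. -/
noncomputable def moduleN (k : Type u) [Field k] (n : ℕ) : Rep k ((Vtx n)ᵒᵖ × Vtx n) :=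
  standardModule k (fun p => p.2 ≤ p.1.unop)
    (fun _ _ _ _ g _ hc => (leOfHom g.2).trans (hc.trans (leOfHom g.1.unop)))

/-- The `k`-linear dual `D(kI)` of the path algebra as a bimodule: its value at `(i, j)` is the dual
of the space of paths from `j` to `i`, that is, the space of functions on this set of paths. -/
noncomputable def dualBimodule (k : Type u) [Field k] (I : Type) [SmallCategory I]
    [FinCategory I] : Rep k (Iᵒᵖ × I) where
  obj p := FGModuleCat.of k ((p.2 ⟶ p.1.unop) → k)
  map f := FGModuleCat.ofHom (LinearMap.funLeft k k (fun g => f.2 ≫ g ≫ f.1.unop))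
  map_id p := by
    refine FGModuleCat.hom_ext (LinearMap.ext fun (x : (p.2 ⟶ p.1.unop) → k) => funext fun g => ?_)
    change x (𝟙 p.2 ≫ g ≫ 𝟙 p.1.unop) = x g
    simp
  map_comp {p q r} f g := by
    refine FGModuleCat.hom_ext (LinearMap.ext fun (x : (p.2 ⟶ p.1.unop) → k) => funext fun h => ?_)
    change x ((f.2 ≫ g.2) ≫ h ≫ (g.1.unop ≫ f.1.unop)) =
      x (f.2 ≫ (g.2 ≫ h ≫ g.1.unop) ≫ f.1.unop)
    simp

/-! ### Tensor products -/

instance hasCoend (k : Type u) [Field k] (I : Type) [SmallCategory I] [FinCategory I]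
    (F : Iᵒᵖ ⥤ I ⥤ FGModuleCat.{u} k) : HasCoend F := by
  classical
  have : Fintype (multispanShapeCoend I).L :=
    Fintype.ofEquiv (Σ p : I × I, (p.1 ⟶ p.2))
      { toFun := fun p => Arrow.mk p.2
        invFun := fun f => ⟨(f.left, f.right), f.hom⟩
        left_inv := fun _ => rfl
        right_inv := fun _ => rfl }
  have : Fintype (multispanShapeCoend I).R := inferInstanceAs (Fintype I)
  dsimp only [HasCoend, HasMulticoequalizer]
  infer_instance

/-- The family `X(i) ⊗ B(i', j)`, contravariant in `i'` and covariant in `i`. -/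
@[simps]
def integrand {C : Type w} [Category.{v} C] [MonoidalCategory C] {I J : Type} [SmallCategory I]
    [SmallCategory J] (B : Iᵒᵖ ⥤ J ⥤ C) (X : I ⥤ C) (j : J) : Iᵒᵖ ⥤ I ⥤ C where
  obj i' :=
    { obj := fun i => X.obj i ⊗ (B.obj i').obj j
      map := fun f => X.map f ▷ (B.obj i').obj j }
  map g :=
    { app := fun i => X.obj i ◁ (B.map g).app j
      naturality := fun _ _ f => (whisker_exchange (X.map f) ((B.map g).app j)).symm }

/-- The dependence of `integrand` on `j`. -/
@[simps]
def integrandMapRight {C : Type w} [Category.{v} C] [MonoidalCategory C] {I J : Type}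
    [SmallCategory I] [SmallCategory J] (B : Iᵒᵖ ⥤ J ⥤ C) (X : I ⥤ C) {j j' : J} (g : j ⟶ j') :
    integrand B X j ⟶ integrand B X j' where
  app i' :=
    { app := fun i => X.obj i ◁ (B.obj i').map g
      naturality := fun _ _ f => (whisker_exchange (X.map f) ((B.obj i').map g)).symm }
  naturality i' i'' f := NatTrans.ext (funext fun i =>
    (by simp [← MonoidalCategory.whiskerLeft_comp] :
      X.obj i ◁ (B.map f).app j ≫ X.obj i ◁ (B.obj i'').map g =
        X.obj i ◁ (B.obj i').map g ≫ X.obj i ◁ (B.map f).app j'))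

/-- The dependence of `integrand` on `X`. -/
@[simps]
def integrandMapLeft {C : Type w} [Category.{v} C] [MonoidalCategory C] {I J : Type}
    [SmallCategory I] [SmallCategory J] (B : Iᵒᵖ ⥤ J ⥤ C) {X Y : I ⥤ C} (f : X ⟶ Y) (j : J) :
    integrand B X j ⟶ integrand B Y j where
  app i' :=
    { app := fun i => f.app i ▷ (B.obj i').obj j
      naturality := fun a b g =>
        (by simp [← comp_whiskerRight] :
          X.map g ▷ (B.obj i').obj j ≫ f.app b ▷ (B.obj i').obj j =
            f.app a ▷ (B.obj i').obj j ≫ Y.map g ▷ (B.obj i').obj j) }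
  naturality i' i'' g := NatTrans.ext (funext fun i =>
    whisker_exchange (f.app i) ((B.map g).app j))

/-- The functor sending `X` to the coend of `X(i) ⊗ B(i', j)`. -/
@[simps]
noncomputable def coendTensor {C : Type w} [Category.{v} C] [MonoidalCategory C] {I J : Type}
    [SmallCategory I] [SmallCategory J] [∀ F : Iᵒᵖ ⥤ I ⥤ C, HasCoend F] (B : Iᵒᵖ ⥤ J ⥤ C) :
    (I ⥤ C) ⥤ (J ⥤ C) where
  obj X :=
    { obj := fun j => coend (integrand B X j)
      map := fun g => coend.map (integrandMapRight B X g)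
      map_id := fun j => by
        have h : integrandMapRight B X (𝟙 j) = 𝟙 _ :=
          NatTrans.ext (funext fun i' => NatTrans.ext (funext fun i =>
            (by simp : X.obj i ◁ (B.obj i').map (𝟙 j) = 𝟙 (X.obj i ⊗ (B.obj i').obj j))))
        rw [h, coend.map_id]
      map_comp := fun g g' => by
        have h : integrandMapRight B X (g ≫ g') =
            integrandMapRight B X g ≫ integrandMapRight B X g' :=
          NatTrans.ext (funext fun i' => NatTrans.ext (funext fun i =>
            (by simp : X.obj i ◁ (B.obj i').map (g ≫ g') =
              X.obj i ◁ (B.obj i').map g ≫ X.obj i ◁ (B.obj i').map g')))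
        rw [h, coend.map_comp] }
  map {X Y} f :=
    { app := fun j => coend.map (integrandMapLeft B f j)
      naturality := fun j j' g => by
        have h : integrandMapRight B X g ≫ integrandMapLeft B f j' =
            integrandMapLeft B f j ≫ integrandMapRight B Y g :=
          NatTrans.ext (funext fun i' => NatTrans.ext (funext fun i =>
            whisker_exchange (f.app i) ((B.obj i').map g)))
        rw [coend.map_comp, h, coend.map_comp] }
  map_id X := NatTrans.ext (funext fun j => by
    have h : integrandMapLeft B (𝟙 X) j = 𝟙 _ :=
      NatTrans.ext (funext fun i' => NatTrans.ext (funext fun i =>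
        id_whiskerRight (X.obj i) ((B.obj i').obj j)))
    exact (congrArg coend.map h).trans coend.map_id)
  map_comp f g := NatTrans.ext (funext fun j => by
    have h : integrandMapLeft B (f ≫ g) j = integrandMapLeft B f j ≫ integrandMapLeft B g j :=
      NatTrans.ext (funext fun i' => NatTrans.ext (funext fun i =>
        comp_whiskerRight (f.app i) (g.app i) ((B.obj i').obj j)))
    exact (congrArg coend.map h).trans (coend.map_comp _ _).symm)

instance {C : Type w} [Category.{v} C] [MonoidalCategory C] [Preadditive C]
    [MonoidalPreadditive C] {I J : Type} [SmallCategory I] [SmallCategory J]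
    [∀ F : Iᵒᵖ ⥤ I ⥤ C, HasCoend F] (B : Iᵒᵖ ⥤ J ⥤ C) : (coendTensor B).Additive where
  map_add {X Y f g} := NatTrans.ext (funext fun j => coend.hom_ext fun i => by
    change coend.ι (integrand B X j) i ≫ coend.map (integrandMapLeft B (f + g) j) =
      coend.ι (integrand B X j) i ≫
        (coend.map (integrandMapLeft B f j) + coend.map (integrandMapLeft B g j))
    rw [Preadditive.comp_add, coend.ι_map, coend.ι_map, coend.ι_map, ← Preadditive.add_comp]
    exact congrArg (fun t => t ≫ coend.ι (integrand B Y j) i)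
      (MonoidalPreadditive.add_whiskerRight (X := (B.obj (op i)).obj j) (f.app i) (g.app i)))

/-- The functor `? ⊗_I B` from `I`-modules to `J`-modules, for an `Iᵒᵖ × J`-module `B`, as a coend:
`(X ⊗_I B)(j)` is the quotient of the direct sum of the spaces `X(i) ⊗ B(i, j)` by the relations
`x f ⊗ b = x ⊗ f b` for all paths `f` in `I`. -/
noncomputable def tensorFunctor {k : Type u} [Field k] {I J : Type} [SmallCategory I] [FinCategory I]
    [SmallCategory J] (B : Rep k (Iᵒᵖ × J)) : Rep k I ⥤ Rep k J :=
  coendTensor (Functor.curry.obj B)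

instance {k : Type u} [Field k] {I J : Type} [SmallCategory I] [FinCategory I]
    [SmallCategory J] (B : Rep k (Iᵒᵖ × J)) : (tensorFunctor B).Additive :=
  inferInstanceAs (coendTensor (Functor.curry.obj B)).Additive

/-- The functor `Id × Φ`: apply `Φ` to a module in the second variable. -/
def inSnd (k : Type u) [Field k] (E : Type) [SmallCategory E] {I J : Type} [SmallCategory I]
    [SmallCategory J] (Φ : Rep k I ⥤ Rep k J) : Rep k (E × I) ⥤ Rep k (E × J) :=
  Functor.curry ⋙ (Functor.whiskeringRight E (Rep k I) (Rep k J)).obj Φ ⋙ Functor.uncurry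

instance (k : Type u) [Field k] (E : Type) [SmallCategory E] {I J : Type} [SmallCategory I]
    [SmallCategory J] (Φ : Rep k I ⥤ Rep k J) [Φ.Additive] : (inSnd k E Φ).Additive where
  map_add {X Y f g} := by
    refine NatTrans.ext (funext fun p => ?_)
    have h : (Functor.curry.map (f + g)).app p.1 =
      (Functor.curry.map f).app p.1 + (Functor.curry.map g).app p.1 := rfl
    have h' := congrArg (fun t => NatTrans.app (Φ.map t) p.2) h
    rw [Φ.map_add] at h'
    exact h'

/-- The flip functor `X` from `I × J`-modules to `J × I`-modules. -/
def exchangeFactors (k : Type u) [Field k] (I J : Type) [SmallCategory I] [SmallCategory J] :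
    Rep k (I × J) ⥤ Rep k (J × I) :=
  (Functor.whiskeringLeft _ _ _).obj (CategoryTheory.Prod.swap J I)

instance (k : Type u) [Field k] (I J : Type) [SmallCategory I] [SmallCategory J] :
    (exchangeFactors k I J).Additive where
  map_add := rfl

/-- The functor `Φ × Id`: apply `Φ` to a module in the first variable. -/
def inFst (k : Type u) [Field k] (E : Type) [SmallCategory E] {I J : Type} [SmallCategory I]
    [SmallCategory J] (Φ : Rep k I ⥤ Rep k J) : Rep k (I × E) ⥤ Rep k (J × E) :=
  exchangeFactors k I E ⋙ inSnd k E Φ ⋙ exchangeFactors k E J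

instance (k : Type u) [Field k] (E : Type) [SmallCategory E] {I J : Type} [SmallCategory I]
    [SmallCategory J] (Φ : Rep k I ⥤ Rep k J) [Φ.Additive] : (inFst k E Φ).Additive := by
  unfold inFst
  infer_instance

/-- The functor `∇_{m;i}^n = ? ⊗ M_{m;i}^n` from `A_l`-modules to `A_m × A_n`-modules, where
`l = m + n - 1`. -/
noncomputable def nabla (k : Type u) [Field k] (l m i n : ℕ) (h : l = m + n - 1) :
    Rep k (Vtx l) ⥤ Rep k (Vtx m × Vtx n) :=
  tensorFunctor (moduleM k l m i n h)

instance (k : Type u) [Field k] (l m i n : ℕ) (h : l = m + n - 1) :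
    (nabla k l m i n h).Additive := by
  unfold nabla
  infer_instance

/-- The underived Nakayama functor `? ⊗ D(kI)`. -/
noncomputable def nakayama (k : Type u) [Field k] (I : Type) [SmallCategory I] [FinCategory I] :
    Rep k I ⥤ Rep k I :=
  tensorFunctor (dualBimodule k I)

instance (k : Type u) [Field k] (I : Type) [SmallCategory I] [FinCategory I] :
    (nakayama k I).Additive := by
  unfold nakayama
  infer_instance

/-! ### Derived categories -/

/-- The bounded derived category of finite-dimensional modules. -/
abbrev Db (k : Type u) [Field k] (I : Type) [SmallCategory I] :=
  DerivedCategory.Bounded (Rep k I)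

/-- A module, seen as an object of the bounded derived category concentrated in degree `0`. -/
noncomputable def inDegreeZero {k : Type u} [Field k] {I : Type} [SmallCategory I] (M : Rep k I) :
    Db k I :=
  ⟨(DerivedCategory.singleFunctor (Rep k I) 0).obj M, ⟨0, inferInstance⟩, ⟨0, inferInstance⟩⟩

/-- `G` is a left derived functor of `F` on the bounded derived categories: it is the restriction
of a total left derived functor `L` of `F`, that is, of a right Kan extension of `F` along the
localization of complexes at quasi-isomorphisms. -/
def IsLeftDerived {k : Type u} [Field k] {I J : Type} [SmallCategory I] [SmallCategory J]
    (F : Rep k I ⥤ Rep k J) [F.Additive] (G : Db k I ⥤ Db k J) : Prop :=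
  ∃ (L : DerivedCategory (Rep k I) ⥤ DerivedCategory (Rep k J))
    (α : DerivedCategory.Q ⋙ L ⟶
      F.mapHomologicalComplex (ComplexShape.up ℤ) ⋙ DerivedCategory.Q),
    L.IsLeftDerivedFunctor α (HomologicalComplex.quasiIso (Rep k I) (ComplexShape.up ℤ)) ∧
    Nonempty (G ⋙ DerivedCategory.Bounded.ι ≅ DerivedCategory.Bounded.ι ⋙ L)

/-- `τ` is the Auslander-Reiten translation attached to a Nakayama functor `ν`, namely
`S⁻¹ ∘ Lν`, where `Lν` is the left derived functor of `ν` and `S` is the shift. -/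
def IsTranslation {k : Type u} [Field k] {I : Type} [SmallCategory I]
    (ν : Rep k I ⥤ Rep k I) [ν.Additive] (τ : Db k I ⥤ Db k I) : Prop :=
  ∃ G : Db k I ⥤ Db k I, IsLeftDerived ν G ∧
    Nonempty (τ ≅ G ⋙ shiftFunctor (Db k I) (-1 : ℤ))

end TypeA

open TypeA

/-! Over a linear quiver everything reduces to comparing images inside one vector space. For fixed
`(μ, ν)` the module `M_{m;1}^n` is supported on `γ ≤ c₁(μ, ν)`, hence representable, so `∇_{m;1}^n`
is restriction along the monotone map `c₁ = heightFirst`. Likewise `∇_{n;n}^m` is restriction along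
`c₂ = heightLast` (`pullIsoTensor`). Both are therefore exact. The underived Nakayama functor is the
tensor product with `N_a`; it sends `X` to `j ↦ X(a) / im X(j - 1)`, where `X(0) = 0`
(`TopQuotient`).

Thus `∇_{m;1}^n ν_l X` is at `(μ, ν)` the quotient of `X(l)` by the images of the `X(i)` with `i <
c₁(μ, ν)`. Applying `ν_m` and then `ν_n` to `c₂^* X` gives the quotient of `X(l)` by the images of
`X(c₂(ν', m))` for `ν' < ν` and of `X(c₂(n, μ'))` for `μ' < μ`. Both families of vertices have the
same down-closure (`Interlaced`, checked by arithmetic in `interlaced`), so the quotients agree: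
this is the underived isomorphism `interlacedIso`.

To derive it, each quotient is presented as the cokernel of a map between exact functors, and the
cone of this map is the left derived functor (`Presentation.derivedData`). Complexes have functorial
resolutions by representations on which all paths act injectively (`injectiveActionResolution`), and
on these both composites are computed without deriving. The delicate point is that `ν_m c₂^*` sends
them to objects acyclic for `ν_n` (`acyclic_inFst`), because `c₂(ν', μ)` does not depend on `μ` when
`ν' < n`. Uniqueness of left derived functors gives the isomorphism of functors, with one `S⁻¹` on
the left against `S⁻² S` on the right.

The isomorphism of bimodules is the underived isomorphism evaluated at the path algebra of `A_l`:
`N_l` is its Nakayama image and `M_{n;n}^m` its restriction along `c₂`. -/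

namespace TypeA

/-! ### Left derived functors from functorial resolutions -/

section Resolution

variable {C D H : Type*} [Category* C] [Category* D] [Category* H]

/-- If every object `K` receives a map of `W` from an object `P K`, functorially in `K`, on which
`α` is an isomorphism, then `α` exhibits a left derived functor. -/
lemma isLeftDerivedFunctor_of_resolution {q : C ⥤ D} {W : MorphismProperty C}
    [q.IsLocalization W] {Ψ : C ⥤ H} {L : D ⥤ H} (α : q ⋙ L ⟶ Ψ) (P : C ⥤ C) (p : P ⟶ 𝟭 C)
    (hp : ∀ K, W (p.app K)) (hα : ∀ K, IsIso (α.app (P.obj K))) :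
    L.IsLeftDerivedFunctor α W := by
  have hq : ∀ K, IsIso (q.map (p.app K)) := fun K => Localization.inverts q W _ (hp K)
  -- The formula is forced: `q (p K)` is invertible, so a map out of `G (q K)` may be computed at `P
  -- K`, where `α` has an inverse.
  let lift (G : D ⥤ H) (β : q ⋙ G ⟶ Ψ) : q ⋙ G ⟶ q ⋙ L :=
    { app := fun K => inv (G.map (q.map (p.app K))) ≫ β.app (P.obj K) ≫
        inv (α.app (P.obj K)) ≫ L.map (q.map (p.app K))
      naturality := fun K K' f => by
        have hβ := β.naturality (P.map f)
        have hα' := α.naturality (P.map f)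
        have hp' := p.naturality f
        dsimp at hβ hα' hp' ⊢
        have h1 : G.map (q.map f) ≫ inv (G.map (q.map (p.app K'))) =
            inv (G.map (q.map (p.app K))) ≫ G.map (q.map (P.map f)) := by
          rw [IsIso.comp_inv_eq, Category.assoc, IsIso.eq_inv_comp, ← G.map_comp, ← G.map_comp,
            ← q.map_comp, ← q.map_comp, hp']
        have h2 : L.map (q.map (P.map f)) ≫ L.map (q.map (p.app K')) =
            L.map (q.map (p.app K)) ≫ L.map (q.map f) := by
          rw [← L.map_comp, ← L.map_comp, ← q.map_comp, ← q.map_comp, hp']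
        have h3 : Ψ.map (P.map f) ≫ inv (α.app (P.obj K')) =
            inv (α.app (P.obj K)) ≫ L.map (q.map (P.map f)) := by
          rw [IsIso.comp_inv_eq, Category.assoc, IsIso.eq_inv_comp, hα']
        rw [reassoc_of% h1, reassoc_of% hβ, reassoc_of% h3, h2]
        simp only [Category.assoc] }
  have lift_fac (G : D ⥤ H) (β : q ⋙ G ⟶ Ψ) : lift G β ≫ α = β := by
    ext K
    have hβ := β.naturality (p.app K)
    have hα' := α.naturality (p.app K)
    dsimp [lift] at hβ hα' ⊢
    simp only [Category.assoc]
    rw [hα', IsIso.inv_hom_id_assoc, ← hβ, IsIso.inv_hom_id_assoc]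
  -- At `P K` the isomorphism `α` can be cancelled; the equality then moves to `K` along the
  -- invertible `q (p K)`.
  have lift_uniq (G : D ⥤ H) (γ γ' : q ⋙ G ⟶ q ⋙ L) (h : γ ≫ α = γ' ≫ α) : γ = γ' := by
    ext K
    have h1 := congrArg (fun t => t.app (P.obj K)) h
    dsimp at h1
    have h2 := γ.naturality (p.app K)
    have h3 := γ'.naturality (p.app K)
    rw [cancel_mono] at h1
    rw [h1, ← h3] at h2
    dsimp at h2
    exact (cancel_epi (G.map (q.map (p.app K)))).1 h2
  -- Precomposition with a localization is fully faithful, so transformations constructed on `C`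
  -- come from unique ones on `D`.
  refine ⟨⟨⟨IsTerminal.ofUniqueHom (fun E => CostructuredArrow.homMk
    ((Localization.whiskeringLeftFunctor' q W H).preimage (lift E.left E.hom)) ?_) ?_⟩⟩⟩
  · have := (Localization.whiskeringLeftFunctor' q W H).map_preimage (lift E.left E.hom)
    exact (congrArg (fun t => t ≫ α) this).trans (lift_fac _ _)
  · intro E m
    refine CostructuredArrow.hom_ext _ _ ((Localization.whiskeringLeftFunctor' q W H).map_injective
      (lift_uniq E.left _ _ ?_))
    have := (Localization.whiskeringLeftFunctor' q W H).map_preimage (lift E.left E.hom)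
    refine Eq.trans ?_ (congrArg (fun t => t ≫ α) this).symm |>.trans ?_
    · exact (CostructuredArrow.w m).trans (lift_fac E.left E.hom).symm
    · rfl

end Resolution

/-! ### Functorial mapping cones -/

section Cone

variable (B : Type*) [Category* B] [Abelian B]

/-- The mapping cone of the first map of a short complex of cochain complexes. -/
@[simps]
noncomputable def coneFunctor :
    ShortComplex (CochainComplex B ℤ) ⥤ CochainComplex B ℤ where
  obj S := CochainComplex.mappingCone S.f
  map f := CochainComplex.mappingCone.map _ _ f.τ₁ f.τ₂ f.comm₁₂.symm
  map_id _ := CochainComplex.mappingCone.map_id _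
  map_comp _ _ := CochainComplex.mappingCone.map_comp _ _ _ _ _ _ _ _ _

/-- The comparison of the mapping cone with the third complex. -/
@[simps]
noncomputable def coneFunctorDesc : coneFunctor B ⟶ ShortComplex.π₃ where
  app S := CochainComplex.mappingCone.descShortComplex S
  naturality _ _ f := CochainComplex.mappingCone.descShortComplex_naturality f

end Cone

/-! ### Functorial resolutions of unbounded complexes -/

section Presentation

variable {A B E : Type*} [Category* A] [Category* B] [Category* E] [Abelian A] [Abelian B]
  [Abelian E]

/-- A functorial resolution of complexes by complexes with terms in `M`. -/
structure Resolution (M : ObjectProperty A) where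
  /-- the resolution -/
  P : CochainComplex A ℤ ⥤ CochainComplex A ℤ
  /-- the augmentation -/
  p : P ⟶ 𝟭 _
  quasiIso (K : CochainComplex A ℤ) : QuasiIso (p.app K)
  mem (K : CochainComplex A ℤ) (i : ℤ) : M ((P.obj K).X i)

/-- The short complex `ker r ⟶ R K ⟶ K`, for a natural transformation `r : R ⟶ Id`. -/
@[simps]
noncomputable def kernelShortComplex (R : A ⥤ A) [R.PreservesZeroMorphisms] (r : R ⟶ 𝟭 A) :
    CochainComplex A ℤ ⥤ ShortComplex (CochainComplex A ℤ) where
  obj K := ShortComplex.mk (kernel.ι ((NatTrans.mapHomologicalComplex r (.up ℤ)).app K))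
    ((NatTrans.mapHomologicalComplex r (.up ℤ)).app K) (kernel.condition _)
  map f :=
    { τ₁ := kernel.map _ _ ((R.mapHomologicalComplex _).map f)
        (((𝟭 A).mapHomologicalComplex _).map f)
        ((NatTrans.mapHomologicalComplex r (.up ℤ)).naturality f).symm
      τ₂ := (R.mapHomologicalComplex _).map f
      τ₃ := ((𝟭 A).mapHomologicalComplex _).map f
      comm₁₂ := by simp
      comm₂₃ := (NatTrans.mapHomologicalComplex r (.up ℤ)).naturality f }
  map_id K := by
    ext1
    · simp [kernel.map]
    · simp
    · simp
  map_comp f g := by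
    ext1
    · apply equalizer.hom_ext
      simp
    · simp
    · simp

lemma kernelShortComplex_shortExact (R : A ⥤ A) [R.PreservesZeroMorphisms] (r : R ⟶ 𝟭 A)
    (hr : ∀ X, Epi (r.app X)) (K : CochainComplex A ℤ) :
    ((kernelShortComplex R r).obj K).ShortExact := by
  have : Epi ((NatTrans.mapHomologicalComplex r (.up ℤ)).app K) :=
    have (i : ℤ) : Epi (((NatTrans.mapHomologicalComplex r (.up ℤ)).app K).f i) := hr _
    HomologicalComplex.epi_of_epi_f _ inferInstance
  have h := ShortComplex.exact_kernel ((NatTrans.mapHomologicalComplex r (.up ℤ)).app K)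
  exact { exact := h, mono_f := equalizer.ι_mono, epi_g := this }

/-- The functorial resolution attached to a functor `R` with a natural epimorphism to the identity,
if the values of `R` have a property which is inherited by objects with a jointly monomorphic pair
of maps to objects with this property. -/
noncomputable def Resolution.ofEpi {M : ObjectProperty A}
    (hM : ∀ ⦃X Y Z : A⦄ (f : X ⟶ Y) (g : X ⟶ Z), (∀ ⦃W : A⦄ (a b : W ⟶ X), a ≫ f = b ≫ f →
      a ≫ g = b ≫ g → a = b) → M Y → M Z → M X)
    (R : A ⥤ A) [R.PreservesZeroMorphisms] (r : R ⟶ 𝟭 A) (hr : ∀ X, Epi (r.app X))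
    (hR : ∀ X, M (R.obj X)) : Resolution M where
  P := kernelShortComplex R r ⋙ coneFunctor A
  p := Functor.whiskerLeft (kernelShortComplex R r) (coneFunctorDesc A)
  quasiIso K := CochainComplex.mappingCone.quasiIso_descShortComplex
    (kernelShortComplex_shortExact R r hr K)
  mem K i := by
    let φ := kernel.ι ((NatTrans.mapHomologicalComplex r (.up ℤ)).app K)
    -- Degree `i` of the cone embeds into the kernel in degree `i + 1` times `R (K.X i)`, and that
    -- kernel embeds into `R (K.X (i + 1))`.
    refine hM ((CochainComplex.mappingCone.fst φ).1.v i (i + 1) rfl)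
      ((CochainComplex.mappingCone.snd φ).v i i (add_zero i)) (fun W a b h h' => ?_) ?_ (hR (K.X i))
    · exact CochainComplex.mappingCone.ext_to φ i (i + 1) rfl h h'
    · have : Mono (φ.f (i + 1)) := inferInstance
      exact hM (φ.f (i + 1)) (φ.f (i + 1)) (fun W a b h _ => (cancel_mono _).1 h)
        (hR (K.X (i + 1))) (hR (K.X (i + 1)))

end Presentation

end TypeA

namespace TypeA

/-! ### Explicit models of left derived functors -/

section DerivedData

variable {A B E : Type*} [Category* A] [Category* B] [Category* E] [Abelian A] [Abelian B]
  [Abelian E]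

/-- A presentation of a functor as the cokernel of a map between exact functors. -/
structure Presentation (Φ : A ⥤ B) where
  /-- the relations -/
  s : A ⥤ B
  /-- the generators -/
  t : A ⥤ B
  s_additive : s.Additive := by infer_instance
  t_additive : t.Additive := by infer_instance
  s_exact : ∀ S : ShortComplex A, S.Exact → (S.map s).Exact
  t_exact : ∀ S : ShortComplex A, S.Exact → (S.map t).Exact
  /-- the inclusion of the relations -/
  θ : s ⟶ t
  /-- the projection -/
  π : t ⟶ Φ
  w (X : A) : θ.app X ≫ π.app X = 0
  exact (X : A) : (ShortComplex.mk (θ.app X) (π.app X) (w X)).Exact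
  epi (X : A) : Epi (π.app X)

attribute [instance] Presentation.s_additive Presentation.t_additive

/-- The objects on which the generators have no syzygies. -/
def Presentation.Acyclic {Φ : A ⥤ B} (p : Presentation Φ) : ObjectProperty A :=
  fun X => Mono (p.θ.app X)

/-- The presentation of a functor, applied to complexes. -/
def Presentation.shortComplex {Φ : A ⥤ B} [Φ.Additive] (p : Presentation Φ) :
    CochainComplex A ℤ ⥤ ShortComplex (CochainComplex B ℤ) where
  obj K := ShortComplex.mk ((NatTrans.mapHomologicalComplex p.θ (.up ℤ)).app K)
    ((NatTrans.mapHomologicalComplex p.π (.up ℤ)).app K) (by ext i; exact p.w (K.X i))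
  map f :=
    { τ₁ := (p.s.mapHomologicalComplex _).map f
      τ₂ := (p.t.mapHomologicalComplex _).map f
      τ₃ := (Φ.mapHomologicalComplex _).map f
      comm₁₂ := (NatTrans.mapHomologicalComplex p.θ (.up ℤ)).naturality f
      comm₂₃ := (NatTrans.mapHomologicalComplex p.π (.up ℤ)).naturality f }

instance Presentation.isClosedUnderIsomorphisms {Φ : A ⥤ B} (p : Presentation Φ) :
    p.Acyclic.IsClosedUnderIsomorphisms where
  of_iso {X _} e (hX : Mono (p.θ.app X)) :=
    ((MorphismProperty.monomorphisms B).arrow_mk_iso_iff (Arrow.isoMk (p.s.mapIso e)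
      (p.t.mapIso e) (p.θ.naturality e.hom))).1 hX

lemma Presentation.acyclic_of_isZero {Φ : A ⥤ B} (p : Presentation Φ) {X : A} (hX : IsZero X) :
    p.Acyclic X :=
  ⟨fun _ _ _ => (p.s.map_isZero hX).eq_of_tgt _ _⟩

/-- This makes the cone of `θ` quasi-isomorphic to the value of `Φ` on complexes with acyclic terms,
which is why the cone models the derived functor. -/
lemma Presentation.shortComplex_shortExact {Φ : A ⥤ B} [Φ.Additive] (p : Presentation Φ)
    (K : CochainComplex A ℤ) (hK : ∀ i, p.Acyclic (K.X i)) :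
    (p.shortComplex.obj K).ShortExact :=
  HomologicalComplex.shortExact_of_degreewise_shortExact _ fun i =>
    { exact := p.exact (K.X i), mono_f := hK i, epi_g := p.epi (K.X i) }

lemma preservesFiniteLimits_and_colimits {F : A ⥤ B} [F.Additive]
    (h : ∀ S : ShortComplex A, S.Exact → (S.map F).Exact) :
    PreservesFiniteLimits F ∧ PreservesFiniteColimits F :=
  ((Functor.exact_tfae F).out 1 3).1 h

/-- The functors induced on complexes by a composition. -/
def mapHomologicalComplexComp (Φ : A ⥤ B) [Φ.Additive] (Ψ : B ⥤ E) [Ψ.Additive] :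
    Φ.mapHomologicalComplex (.up ℤ) ⋙ Ψ.mapHomologicalComplex (.up ℤ) ≅
      (Φ ⋙ Ψ).mapHomologicalComplex (.up ℤ) :=
  NatIso.ofComponents (fun K => HomologicalComplex.Hom.isoOfComponents (fun _ => Iso.refl _)
    fun _ _ _ => (Category.id_comp _).trans (Category.comp_id _).symm)
    fun _ => by ext; exact (Category.comp_id _).trans (Category.id_comp _).symm

variable [HasDerivedCategory B]

/-- The derived category objects which are bounded for the canonical t-structure. -/
abbrev IsBounded (X : DerivedCategory B) : Prop := DerivedCategory.TStructure.t.bounded X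

lemma isBounded_Q_obj_map (F : A ⥤ B) [F.Additive] (K : CochainComplex A ℤ) (a b : ℤ)
    [K.IsStrictlyGE a] [K.IsStrictlyLE b] :
    IsBounded (DerivedCategory.Q.obj ((F.mapHomologicalComplex (.up ℤ)).obj K)) := by
  have h₁ : CochainComplex.IsStrictlyGE ((F.mapHomologicalComplex (.up ℤ)).obj K) a := by
    rw [CochainComplex.isStrictlyGE_iff]
    exact fun i hi => F.map_isZero (K.isZero_of_isStrictlyGE a i hi)
  have h₂ : CochainComplex.IsStrictlyLE ((F.mapHomologicalComplex (.up ℤ)).obj K) b := by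
    rw [CochainComplex.isStrictlyLE_iff]
    exact fun i hi => F.map_isZero (K.isZero_of_isStrictlyLE b i hi)
  exact ⟨⟨a, inferInstance⟩, ⟨b, inferInstance⟩⟩

/-- The exact functors `s` and `t` preserve quasi-isomorphisms, and cones inherit this from the map
of distinguished triangles. No acyclicity is needed, so the cone descends to the whole unbounded
derived category. -/
lemma Presentation.isInvertedBy {Φ : A ⥤ B} [Φ.Additive] (p : Presentation Φ) :
    (HomologicalComplex.quasiIso A (.up ℤ)).IsInvertedBy
      (p.shortComplex ⋙ coneFunctor B ⋙ DerivedCategory.Q) := by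
  have := (preservesFiniteLimits_and_colimits p.s_exact).1
  have := (preservesFiniteLimits_and_colimits p.s_exact).2
  have := (preservesFiniteLimits_and_colimits p.t_exact).1
  have := (preservesFiniteLimits_and_colimits p.t_exact).2
  intro K K' f hf
  have : QuasiIso f := hf
  let τ := p.shortComplex.map f
  have h₁ : IsIso (DerivedCategory.Q.map τ.τ₁) :=
    inferInstanceAs (IsIso (DerivedCategory.Q.map ((p.s.mapHomologicalComplex _).map f)))
  have h₂ : IsIso (DerivedCategory.Q.map τ.τ₂) :=
    inferInstanceAs (IsIso (DerivedCategory.Q.map ((p.t.mapHomologicalComplex _).map f)))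
  exact Pretriangulated.isIso₃_of_isIso₁₂
    (DerivedCategory.Q.mapTriangle.map
      (CochainComplex.mappingCone.triangleMap _ _ τ.τ₁ τ.τ₂ τ.comm₁₂.symm))
    (DerivedCategory.mappingCone_triangle_distinguished _)
    (DerivedCategory.mappingCone_triangle_distinguished _) h₁ h₂

variable [HasDerivedCategory A] [HasDerivedCategory E]

/-- A functor between derived categories computing the left derived functor of `Φ`: it comes with
a comparison map which is an isomorphism on complexes with terms in `M`. -/
structure DerivedData (Φ : A ⥤ B) [Φ.Additive] (M : ObjectProperty A) where
  /-- the functor -/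
  L : DerivedCategory A ⥤ DerivedCategory B
  /-- the comparison -/
  α : DerivedCategory.Q ⋙ L ⟶ Φ.mapHomologicalComplex (.up ℤ) ⋙ DerivedCategory.Q
  isIso (K : CochainComplex A ℤ) (hK : ∀ i, M (K.X i)) : IsIso (α.app K)
  bounded (X : DerivedCategory A) (hX : IsBounded X) : IsBounded (L.obj X)

/-- The derived functor of an exact functor. -/
noncomputable def DerivedData.ofExact (Φ : A ⥤ B) [Φ.Additive]
    (h : ∀ S : ShortComplex A, S.Exact → (S.map Φ).Exact) : DerivedData Φ ⊤ :=
  have := (preservesFiniteLimits_and_colimits h).1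
  have := (preservesFiniteLimits_and_colimits h).2
  { L := Φ.mapDerivedCategory
    α := Φ.mapDerivedCategoryFactors.hom
    isIso _ _ := inferInstance
    bounded X hX := by
      obtain ⟨⟨a, ha⟩, ⟨b, hb⟩⟩ := hX
      have : X.IsGE a := ha
      have : X.IsLE b := hb
      obtain ⟨K, _, _, ⟨e⟩⟩ := DerivedCategory.exists_iso_Q_obj_of_isGE_of_isLE X a b
      exact ObjectProperty.prop_of_iso _ ((Φ.mapDerivedCategory.mapIso e ≪≫
        Φ.mapDerivedCategoryFactors.app K).symm) (isBounded_Q_obj_map Φ K a b) }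

/-- The derived functor of a functor with a presentation by exact functors. -/
noncomputable def Presentation.derivedData {Φ : A ⥤ B} [Φ.Additive] (p : Presentation Φ) :
    DerivedData Φ p.Acyclic where
  L := Localization.lift _ p.isInvertedBy DerivedCategory.Q
  α := (Localization.fac _ p.isInvertedBy DerivedCategory.Q).hom ≫
    Functor.whiskerRight (Functor.whiskerLeft p.shortComplex (coneFunctorDesc B)) DerivedCategory.Q
  isIso K hK := by
    have : QuasiIso ((coneFunctorDesc B).app (p.shortComplex.obj K)) :=
      CochainComplex.mappingCone.quasiIso_descShortComplex (p.shortComplex_shortExact K hK)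
    exact IsIso.comp_isIso' inferInstance (inferInstanceAs (IsIso
      (DerivedCategory.Q.map ((coneFunctorDesc B).app (p.shortComplex.obj K)))))
  bounded X hX := by
    obtain ⟨⟨a, ha⟩, ⟨b, hb⟩⟩ := hX
    have : X.IsGE a := ha
    have : X.IsLE b := hb
    obtain ⟨K, _, _, ⟨e⟩⟩ := DerivedCategory.exists_iso_Q_obj_of_isGE_of_isLE X a b
    refine ObjectProperty.prop_of_iso _ (((Localization.lift _ p.isInvertedBy _).mapIso e ≪≫
        (Localization.fac _ p.isInvertedBy DerivedCategory.Q).app K).symm) ?_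
    exact DerivedCategory.TStructure.t.bounded.ext_of_isTriangulatedClosed₃ _
      (DerivedCategory.mappingCone_triangle_distinguished (p.shortComplex.obj K).f)
      (isBounded_Q_obj_map p.s K a b) (isBounded_Q_obj_map p.t K a b)

namespace DerivedData

variable {Φ Φ' : A ⥤ B} [Φ.Additive] [Φ'.Additive] {M M' : ObjectProperty A}

lemma isLeftDerivedFunctor (d : DerivedData Φ M) (r : Resolution M) :
    d.L.IsLeftDerivedFunctor d.α (HomologicalComplex.quasiIso A (.up ℤ)) :=
  isLeftDerivedFunctor_of_resolution d.α r.P r.p r.quasiIso fun K => d.isIso _ (r.mem K)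

/-- The comparison is an isomorphism on fewer objects. -/
def restrict (d : DerivedData Φ M) (h : M' ≤ M) : DerivedData Φ M' where
  L := d.L
  α := d.α
  isIso K hK := d.isIso K fun i => h _ (hK i)
  bounded := d.bounded

/-- Transport along an isomorphism of functors. -/
noncomputable def ofIso (d : DerivedData Φ M) (e : Φ ≅ Φ') : DerivedData Φ' M where
  L := d.L
  α := d.α ≫ Functor.whiskerRight (NatIso.mapHomologicalComplex e (.up ℤ)).hom DerivedCategory.Q
  isIso K hK := by
    have := d.isIso K hK
    rw [NatTrans.comp_app]
    infer_instance
  bounded := d.bounded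

/-- The composition of derived functors. -/
noncomputable def comp {Ψ : B ⥤ E} [Ψ.Additive] {N : ObjectProperty B} (d : DerivedData Φ M)
    (d' : DerivedData Ψ N) : DerivedData (Φ ⋙ Ψ) (fun X => M X ∧ N (Φ.obj X)) where
  L := d.L ⋙ d'.L
  α := Functor.whiskerRight d.α d'.L ≫ Functor.whiskerLeft (Φ.mapHomologicalComplex (.up ℤ)) d'.α ≫
    Functor.whiskerRight (mapHomologicalComplexComp Φ Ψ).hom DerivedCategory.Q
  isIso K hK := by
    have := d.isIso K fun i => (hK i).1
    have := d'.isIso ((Φ.mapHomologicalComplex (.up ℤ)).obj K) fun i => (hK i).2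
    exact IsIso.comp_isIso' (inferInstanceAs (IsIso (d'.L.map (d.α.app K))))
      (IsIso.comp_isIso' this inferInstance)
  bounded X hX := d'.bounded _ (d.bounded X hX)

/-- Derived functors are unique. -/
noncomputable def uniq (d : DerivedData Φ M) (d' : DerivedData Φ M') (r : Resolution M)
    (r' : Resolution M') : d.L ≅ d'.L :=
  have := d.isLeftDerivedFunctor r
  have := d'.isLeftDerivedFunctor r'
  Functor.leftDerivedUnique _ _ d.α d'.α (HomologicalComplex.quasiIso A (.up ℤ))

/-- Derived functors commute with shifts. -/
noncomputable def shiftIso (d : DerivedData Φ M) (r : Resolution M) (a : ℤ) :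
    shiftFunctor _ a ⋙ d.L ≅ d.L ⋙ shiftFunctor _ a :=
  -- Both composites are left derived functors of this one functor, hence isomorphic; no
  -- triangulated structure on `d.L` is used.
  let Ψ := Φ.mapHomologicalComplex (.up ℤ) ⋙ DerivedCategory.Q ⋙
    shiftFunctor (DerivedCategory B) a
  let α₁ : DerivedCategory.Q ⋙ (d.L ⋙ shiftFunctor _ a) ⟶ Ψ :=
    Functor.whiskerRight d.α (shiftFunctor _ a)
  let α₂ : DerivedCategory.Q ⋙ (shiftFunctor _ a ⋙ d.L) ⟶ Ψ :=
    Functor.whiskerRight (DerivedCategory.Q.commShiftIso a).inv d.L ≫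
      Functor.whiskerLeft (shiftFunctor _ a) d.α ≫
      Functor.whiskerRight ((Φ.mapHomologicalComplex (.up ℤ)).commShiftIso a).hom
        DerivedCategory.Q ≫
      Functor.whiskerLeft (Φ.mapHomologicalComplex (.up ℤ))
        (DerivedCategory.Q.commShiftIso a).hom
  have h₁ : (d.L ⋙ shiftFunctor _ a).IsLeftDerivedFunctor α₁
      (HomologicalComplex.quasiIso A (.up ℤ)) :=
    isLeftDerivedFunctor_of_resolution _ r.P r.p r.quasiIso fun K => by
      have := d.isIso _ (r.mem K)
      dsimp [α₁]
      infer_instance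
  have h₂ : (shiftFunctor _ a ⋙ d.L).IsLeftDerivedFunctor α₂
      (HomologicalComplex.quasiIso A (.up ℤ)) :=
    isLeftDerivedFunctor_of_resolution _ r.P r.p r.quasiIso fun K => by
      have := d.isIso ((r.P.obj K)⟦a⟧) fun i => r.mem K (i + a)
      dsimp [α₂]
      infer_instance
  Functor.leftDerivedUnique _ _ α₂ α₁ (HomologicalComplex.quasiIso A (.up ℤ))

/-- The value of a derived functor on an acyclic module. -/
noncomputable def singleIso [M.IsClosedUnderIsomorphisms] (d : DerivedData Φ M)
    (hM : ∀ X, IsZero X → M X) (X : A) (hX : M X) :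
    d.L.obj ((DerivedCategory.singleFunctor A 0).obj X) ≅
      (DerivedCategory.singleFunctor B 0).obj (Φ.obj X) :=
  let K := (HomologicalComplex.single A (.up ℤ) 0).obj X
  -- Acyclicity is needed in every degree: the complex has the term `X` in degree zero and zero
  -- objects elsewhere.
  have hK : IsIso (d.α.app K) := d.isIso K fun i => by
    by_cases h : i = 0
    · subst h
      exact M.prop_of_iso (HomologicalComplex.singleObjXSelf (.up ℤ) 0 X).symm hX
    · exact hM _ (HomologicalComplex.isZero_single_obj_X _ _ _ _ h)
  d.L.mapIso ((DerivedCategory.singleFunctorIsoCompQ A 0).app X) ≪≫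
    @asIso _ _ _ _ (d.α.app K) hK ≪≫
    DerivedCategory.Q.mapIso
      ((HomologicalComplex.singleMapHomologicalComplex Φ (.up ℤ) 0).app X) ≪≫
    ((DerivedCategory.singleFunctorIsoCompQ B 0).app (Φ.obj X)).symm

end DerivedData

end DerivedData

end TypeA

namespace TypeA

/-! ### Pointwise calculus in categories of representations -/

section Elements

variable {k : Type u} [Field k] {I J E : Type} [SmallCategory I] [SmallCategory J]
  [SmallCategory E]

/-- The action of a path on a representation. -/
abbrev act (X : Rep k J) {i j : J} (f : i ⟶ j) : X.obj i →ₗ[k] X.obj j := (X.map f).hom.hom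

/-- The components of a map of representations. -/
abbrev cmp {X Y : Rep k J} (η : X ⟶ Y) (j : J) : X.obj j →ₗ[k] Y.obj j := (η.app j).hom.hom

lemma cmp_act {X Y : Rep k J} (η : X ⟶ Y) {i j : J} (f : i ⟶ j) (x : X.obj i) :
    cmp η j (act X f x) = act Y f (cmp η i x) :=
  congrArg (fun t => t.hom.hom x) (η.naturality f)

lemma act_act (X : Rep k J) {i j l : J} (f : i ⟶ j) (g : j ⟶ l) (x : X.obj i) :
    act X g (act X f x) = act X (f ≫ g) x :=
  (congrArg (fun t => t.hom.hom x) (X.map_comp f g)).symm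

lemma act_id (X : Rep k J) (i : J) (x : X.obj i) : act X (𝟙 i) x = x :=
  congrArg (fun t => t.hom.hom x) (X.map_id i)

lemma fgModuleCat_mono_iff {V W : FGModuleCat.{u} k} (f : V ⟶ W) :
    Mono f ↔ Function.Injective f.hom.hom :=
  ((forget₂ (FGModuleCat.{u} k) (ModuleCat k)).mono_map_iff_mono f).symm.trans
    (ModuleCat.mono_iff_injective _)

lemma fgModuleCat_epi_iff {V W : FGModuleCat.{u} k} (f : V ⟶ W) :
    Epi f ↔ Function.Surjective f.hom.hom :=
  ((forget₂ (FGModuleCat.{u} k) (ModuleCat k)).epi_map_iff_epi f).symm.trans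
    (ModuleCat.epi_iff_surjective _)

lemma mono_iff {X Y : Rep k J} (η : X ⟶ Y) : Mono η ↔ ∀ j, Function.Injective (cmp η j) := by
  simp only [NatTrans.mono_iff_mono_app, fgModuleCat_mono_iff]

lemma epi_iff {X Y : Rep k J} (η : X ⟶ Y) : Epi η ↔ ∀ j, Function.Surjective (cmp η j) := by
  simp only [NatTrans.epi_iff_epi_app, fgModuleCat_epi_iff]

lemma fgModuleCat_exact_iff (S : ShortComplex (FGModuleCat.{u} k)) :
    S.Exact ↔ ∀ y, S.g.hom.hom y = 0 → ∃ x, S.f.hom.hom x = y :=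
  (S.exact_map_iff_of_faithful (forget₂ (FGModuleCat.{u} k) (ModuleCat k))).symm.trans
    (ShortComplex.moduleCat_exact_iff _)

lemma exact_iff_exact_evaluation (S : ShortComplex (Rep k J)) :
    S.Exact ↔ ∀ j, (S.map ((evaluation J (FGModuleCat.{u} k)).obj j)).Exact := by
  simp only [ShortComplex.exact_iff_isZero_homology, Functor.isZero_iff]
  exact forall_congr' fun j => (S.mapHomologyIso
    ((evaluation J (FGModuleCat.{u} k)).obj j)).symm.isZero_iff

lemma exact_iff (S : ShortComplex (Rep k J)) :
    S.Exact ↔ ∀ j y, cmp S.g j y = 0 → ∃ x, cmp S.f j x = y := by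
  rw [exact_iff_exact_evaluation]
  exact forall_congr' fun j => fgModuleCat_exact_iff _

/-- Two quotients with the same kernel are isomorphic. -/
noncomputable def isoOfEpi {T G G' : Rep k J} (p : T ⟶ G) (p' : T ⟶ G')
    (hp : ∀ j, Function.Surjective (cmp p j)) (hp' : ∀ j, Function.Surjective (cmp p' j))
    (h : ∀ j y, cmp p j y = 0 ↔ cmp p' j y = 0) : G ≅ G' :=
  have := (epi_iff p).2 hp
  have := (epi_iff p').2 hp'
  have w : kernel.ι p ≫ p' = 0 := by
    ext j x
    exact (h j _).1 (congrArg (fun t => cmp t j x) (kernel.condition p))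
  have w' : kernel.ι p' ≫ p = 0 := by
    ext j x
    exact (h j _).2 (congrArg (fun t => cmp t j x) (kernel.condition p'))
  { hom := Abelian.epiDesc p p' w
    inv := Abelian.epiDesc p' p w'
    hom_inv_id := by rw [← cancel_epi p]; simp
    inv_hom_id := by rw [← cancel_epi p']; simp }

lemma comp_isoOfEpi_hom {T G G' : Rep k J} (p : T ⟶ G) (p' : T ⟶ G')
    (hp : ∀ j, Function.Surjective (cmp p j)) (hp' : ∀ j, Function.Surjective (cmp p' j))
    (h : ∀ j y, cmp p j y = 0 ↔ cmp p' j y = 0) : p ≫ (isoOfEpi p p' hp hp' h).hom = p' := by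
  have := (epi_iff p).2 hp
  exact Abelian.comp_epiDesc _ _ _

/-- Two quotients of a functor with the same kernel are isomorphic. -/
noncomputable def natIsoOfEpi {D : Type*} [Category* D] {T G G' : D ⥤ Rep k J} (p : T ⟶ G)
    (p' : T ⟶ G') (hp : ∀ X j, Function.Surjective (cmp (p.app X) j))
    (hp' : ∀ X j, Function.Surjective (cmp (p'.app X) j))
    (h : ∀ X j y, cmp (p.app X) j y = 0 ↔ cmp (p'.app X) j y = 0) : G ≅ G' :=
  NatIso.ofComponents (fun X => isoOfEpi (p.app X) (p'.app X) (hp X) (hp' X) (h X))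
    fun {X Y} f => by
      have := (epi_iff (p.app X)).2 (hp X)
      rw [← cancel_epi (p.app X), ← p.naturality_assoc, comp_isoOfEpi_hom, p'.naturality,
        ← Category.assoc, comp_isoOfEpi_hom]

/-- The representations on which all paths act by injective maps. -/
def InjectiveAction : ObjectProperty (Rep k J) :=
  fun X => ∀ ⦃i j : J⦄ (f : i ⟶ j), Function.Injective (act X f)

/-- The subrepresentation given by a family of subspaces. -/
noncomputable def subRep (X : Rep k J) (U : ∀ j, Submodule k (X.obj j))
    (hU : ∀ ⦃i j : J⦄ (f : i ⟶ j), U i ≤ (U j).comap (act X f)) : Rep k J where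
  obj j := FGModuleCat.of k (U j)
  map f := FGModuleCat.ofHom ((act X f).restrict (hU f))
  map_id j := by
    refine FGModuleCat.hom_ext (LinearMap.ext fun (x : U j) => Subtype.ext ?_)
    exact act_id X j x.1
  map_comp f g := by
    refine FGModuleCat.hom_ext (LinearMap.ext fun (x : U _) => Subtype.ext ?_)
    exact (act_act X f g x.1).symm

/-- Restriction of representations along a functor. -/
abbrev pull (k : Type u) [Field k] (c : J ⥤ I) : Rep k I ⥤ Rep k J :=
  (Functor.whiskeringLeft J I (FGModuleCat.{u} k)).obj c

lemma pull_exact (c : J ⥤ I) (S : ShortComplex (Rep k I)) (hS : S.Exact) :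
    (S.map (pull k c)).Exact := by
  rw [exact_iff] at hS ⊢
  exact fun j => hS (c.obj j)

/-- The part of a representation which is supported on a cosieve. -/
noncomputable def cutoff (k : Type u) [Field k] (P : J → Prop)
    (hP : ∀ ⦃i j : J⦄, (i ⟶ j) → P i → P j) : Rep k J ⥤ Rep k J where
  obj X := subRep X
    (fun j =>
      { carrier := {x | ¬ P j → x = 0}
        add_mem' := fun ha hb h => by rw [ha h, hb h, add_zero]
        zero_mem' := fun _ => rfl
        smul_mem' := fun c x hx h => by rw [hx h, smul_zero] })
    (fun i j f x hx h => by rw [hx fun h' => h (hP f h'), map_zero])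
  map {X Y} η :=
    { app := fun j => FGModuleCat.ofHom ((cmp η j).restrict fun x hx h => by rw [hx h, map_zero])
      naturality := fun i j f => FGModuleCat.hom_ext (LinearMap.ext fun x =>
        Subtype.ext (cmp_act η f x.1)) }
  map_id _ := rfl
  map_comp _ _ := rfl

instance (P : J → Prop) (hP : ∀ ⦃i j : J⦄, (i ⟶ j) → P i → P j) : (cutoff k P hP).Additive where
  map_add := rfl

lemma cutoff_exact (P : J → Prop) (hP : ∀ ⦃i j : J⦄, (i ⟶ j) → P i → P j)
    (S : ShortComplex (Rep k J)) (hS : S.Exact) : (S.map (cutoff k P hP)).Exact := by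
  rw [exact_iff] at hS ⊢
  rintro j ⟨y, hy⟩ h
  by_cases hj : P j
  · obtain ⟨x, rfl⟩ := hS j y (congrArg Subtype.val h)
    exact ⟨⟨x, fun h => (h hj).elim⟩, rfl⟩
  · exact ⟨0, (map_zero _).trans (Subtype.ext (hy hj).symm)⟩

/-- The inclusion of the part supported on a cosieve. -/
noncomputable def cutoffι (P : J → Prop) (hP : ∀ ⦃i j : J⦄, (i ⟶ j) → P i → P j) :
    cutoff k P hP ⟶ 𝟭 _ where
  app X := { app := fun j => FGModuleCat.ofHom (Submodule.subtype _) }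

lemma cutoffι_injective (P : J → Prop) (hP : ∀ ⦃i j : J⦄, (i ⟶ j) → P i → P j) (X : Rep k J)
    (j : J) : Function.Injective (cmp ((cutoffι P hP).app X) j) := Subtype.val_injective

end Elements

/-! ### Free covers over finite thin categories -/

section Free

variable {k : Type u} [Field k] {J : Type} [SmallCategory J] [FinCategory J]

/-- The free representation on the vector spaces of a representation, for a thin category: its
value at `j` consists of the families supported at the predecessors of `j`. -/
noncomputable def freeCover (k : Type u) [Field k] (J : Type) [SmallCategory J] [FinCategory J] :
    Rep k J ⥤ Rep k J where
  obj X := subRep ((Functor.const J).obj (FGModuleCat.of k (∀ i, X.obj i)))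
    (fun j =>
      { carrier := {x | ∀ i, ¬ Nonempty (i ⟶ j) → x i = 0}
        add_mem' := fun {a b} ha hb i h => by
          change a i + b i = 0
          rw [ha i h, hb i h, add_zero]
        zero_mem' := fun _ _ => rfl
        smul_mem' := fun c x hx i h => by
          change c • x i = 0
          rw [hx i h, smul_zero] })
    (fun i j f x hx l h => hx l fun ⟨g⟩ => h ⟨g ≫ f⟩)
  map {X Y} η :=
    { app := fun j => FGModuleCat.ofHom
        ((LinearMap.pi fun i => cmp η i ∘ₗ LinearMap.proj i).restrict fun x hx i h => by
          change cmp η i (x i) = 0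
          rw [hx i h, map_zero]) }
  map_id _ := rfl
  map_comp _ _ := rfl

instance : (freeCover k J).PreservesZeroMorphisms where
  map_zero _ _ := rfl

lemma freeCover_injectiveAction (X : Rep k J) : InjectiveAction ((freeCover k J).obj X) :=
  fun _ _ _ x y h => by
    have h' := congrArg (fun t => t.1) h
    exact Subtype.ext (a1 := x) (a2 := y) h'

open Classical in
/-- The map from the free representation. -/
noncomputable def freeCoverDesc [Quiver.IsThin J] : freeCover k J ⟶ 𝟭 _ where
  app X :=
    { app := fun j => FGModuleCat.ofHom
        ((∑ i, if h : Nonempty (i ⟶ j) then act X h.some ∘ₗ LinearMap.proj i else 0) ∘ₗ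
          Submodule.subtype _)
      naturality := fun j j' f => FGModuleCat.hom_ext (LinearMap.ext fun x => by
        obtain ⟨x, hx⟩ := x
        change (∑ i, if h : Nonempty (i ⟶ j') then act X h.some ∘ₗ LinearMap.proj i else 0 :
          (∀ i, X.obj i) →ₗ[k] X.obj j') x = act X f ((∑ i, if h : Nonempty (i ⟶ j) then
            act X h.some ∘ₗ LinearMap.proj i else 0 : (∀ i, X.obj i) →ₗ[k] X.obj j) x)
        rw [LinearMap.sum_apply, LinearMap.sum_apply, map_sum]
        refine Finset.sum_congr rfl fun i _ => ?_
        by_cases h : Nonempty (i ⟶ j)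
        · have h' : Nonempty (i ⟶ j') := ⟨h.some ≫ f⟩
          -- Thinness makes the chosen path irrelevant, so it can be replaced by one factoring
          -- through `j`.
          rw [dif_pos h, dif_pos h', Subsingleton.elim h'.some (h.some ≫ f)]
          exact (act_act X _ _ _).symm
        · rw [dif_neg h]
          have hx : x i = 0 := hx i h
          split_ifs
          · simp [hx]
          · simp) }
  naturality X Y η := by
    refine NatTrans.ext (funext fun j => FGModuleCat.hom_ext (LinearMap.ext fun x => ?_))
    obtain ⟨x, hx⟩ := x
    change (∑ i, if h : Nonempty (i ⟶ j) then act Y h.some ∘ₗ LinearMap.proj i else 0 :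
      (∀ i, Y.obj i) →ₗ[k] Y.obj j) (fun i => cmp η i (x i)) =
      cmp η j ((∑ i, if h : Nonempty (i ⟶ j) then
        act X h.some ∘ₗ LinearMap.proj i else 0 : (∀ i, X.obj i) →ₗ[k] X.obj j) x)
    rw [LinearMap.sum_apply, LinearMap.sum_apply, map_sum]
    refine Finset.sum_congr rfl fun i _ => ?_
    split_ifs with h
    · exact (cmp_act η _ _).symm
    · simp

lemma freeCoverDesc_surjective [Quiver.IsThin J] (X : Rep k J) (j : J) :
    Function.Surjective (cmp (freeCoverDesc.app X) j) := by
  classical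
  intro x
  refine ⟨⟨Pi.single j x, fun i h => Pi.single_eq_of_ne ?_ _⟩, ?_⟩
  · rintro rfl
    exact h ⟨𝟙 _⟩
  · change (∑ i, if h : Nonempty (i ⟶ j) then act X h.some ∘ₗ LinearMap.proj i else 0 :
      (∀ i, X.obj i) →ₗ[k] X.obj j) (Pi.single j x) = x
    rw [LinearMap.sum_apply, Finset.sum_eq_single j]
    · rw [dif_pos ⟨𝟙 j⟩, Subsingleton.elim (Nonempty.some _) (𝟙 j)]
      exact (act_id X j _).trans (Pi.single_eq_same (M := fun i => X.obj i) j x)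
    · intro i _ hi
      split_ifs
      · simp [Pi.single_eq_of_ne hi]
      · simp
    · simp

/-- Over a finite poset, complexes have functorial resolutions by representations on which all
paths act injectively. -/
noncomputable def injectiveActionResolution [Quiver.IsThin J] :
    Resolution (InjectiveAction : ObjectProperty (Rep k J)) :=
  -- An element of `X` killed by a path has images in `Y` and `Z` killed by the same path; these
  -- vanish, and `X` embeds into `Y ⊞ Z`.
  Resolution.ofEpi (fun X Y Z f g h hY hZ i j a => by
      have : Mono (biprod.lift f g) := ⟨fun u v huv => h u v
        (by simpa using congrArg (fun t => t ≫ biprod.fst) huv)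
        (by simpa using congrArg (fun t => t ≫ biprod.snd) huv)⟩
      rw [mono_iff] at this
      rw [← LinearMap.ker_eq_bot, LinearMap.ker_eq_bot']
      intro x hx
      have hf : cmp f i x = 0 := hY a (by rw [← cmp_act, hx, map_zero, map_zero])
      have hg : cmp g i x = 0 := hZ a (by rw [← cmp_act, hx, map_zero, map_zero])
      apply this i
      rw [map_zero, biprod.lift_eq]
      change cmp (biprod.inl : Y ⟶ Y ⊞ Z) i (cmp f i x) +
        cmp (biprod.inr : Z ⟶ Y ⊞ Z) i (cmp g i x) = 0
      rw [hf, hg, map_zero, map_zero, add_zero])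
    (freeCover k J) freeCoverDesc (fun X => (epi_iff _).2 (freeCoverDesc_surjective X))
    freeCover_injectiveAction

end Free

end TypeA

namespace TypeA

/-! ### Applying presentations in one variable -/

section InSnd

variable {k : Type u} [Field k] {I J K E : Type} [SmallCategory I] [SmallCategory J]
  [SmallCategory K] [SmallCategory E]

/-- The functor `Id × Φ` depends functorially on `Φ`. -/
def inSndMap (E : Type) [SmallCategory E] {Φ Ψ : Rep k I ⥤ Rep k J} (η : Φ ⟶ Ψ) :
    inSnd k E Φ ⟶ inSnd k E Ψ :=
  Functor.whiskerLeft Functor.curry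
    (Functor.whiskerRight ((Functor.whiskeringRight E _ _).map η) Functor.uncurry)

/-- The functor `Id × Φ` preserves isomorphisms in `Φ`. -/
def inSndIso (E : Type) [SmallCategory E] {Φ Ψ : Rep k I ⥤ Rep k J} (η : Φ ≅ Ψ) :
    inSnd k E Φ ≅ inSnd k E Ψ :=
  Functor.isoWhiskerLeft Functor.curry
    (Functor.isoWhiskerRight ((Functor.whiskeringRight E _ _).mapIso η) Functor.uncurry)

/-- The functor `Id × ?` is compatible with compositions. -/
def inSndComp (E : Type) [SmallCategory E] (Φ : Rep k I ⥤ Rep k J) (Ψ : Rep k J ⥤ Rep k K) :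
    inSnd k E Φ ⋙ inSnd k E Ψ ≅ inSnd k E (Φ ⋙ Ψ) :=
  Functor.isoWhiskerLeft (Functor.curry ⋙ (Functor.whiskeringRight E _ _).obj Φ)
    (Functor.isoWhiskerRight Functor.currying.unitIso.symm
      ((Functor.whiskeringRight E _ _).obj Ψ ⋙ Functor.uncurry))

lemma exact_slice (S : ShortComplex (Rep k (E × I))) (hS : S.Exact) (e : E) :
    (S.map (Functor.curry ⋙ (evaluation E (Rep k I)).obj e)).Exact := by
  rw [exact_iff] at hS ⊢
  exact fun i => hS (e, i)

lemma inSnd_exact (Φ : Rep k I ⥤ Rep k J) [Φ.Additive]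
    (hΦ : ∀ S : ShortComplex (Rep k I), S.Exact → (S.map Φ).Exact)
    (S : ShortComplex (Rep k (E × I))) (hS : S.Exact) : (S.map (inSnd k E Φ)).Exact := by
  have h (e : E) := (exact_iff _).1 (hΦ _ (exact_slice S hS e))
  rw [exact_iff]
  exact fun j => h j.1 j.2

/-- The presentation of `Id × Φ` induced by a presentation of `Φ`. -/
noncomputable def Presentation.inSnd (E : Type) [SmallCategory E] {Φ : Rep k I ⥤ Rep k J}
    (p : Presentation Φ) : Presentation (inSnd k E Φ) where
  s := TypeA.inSnd k E p.s
  t := TypeA.inSnd k E p.t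
  s_exact := inSnd_exact p.s p.s_exact
  t_exact := inSnd_exact p.t p.t_exact
  θ := inSndMap E p.θ
  π := inSndMap E p.π
  w X := NatTrans.ext (funext fun j =>
    congrArg (fun t => t.app j.2) (p.w ((Functor.curry.obj X).obj j.1)))
  exact X := (exact_iff _).2 fun j => (exact_iff _).1 (p.exact ((Functor.curry.obj X).obj j.1)) j.2
  epi X := (epi_iff _).2 fun j => (epi_iff _).1 (p.epi ((Functor.curry.obj X).obj j.1)) j.2

lemma Presentation.inSnd_acyclic {Φ : Rep k I ⥤ Rep k J} (p : Presentation Φ) (X : Rep k (E × I))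
    (hX : ∀ e, p.Acyclic ((Functor.curry.obj X).obj e)) : (p.inSnd E).Acyclic X :=
  (mono_iff _).2 fun j => (mono_iff _).1 (hX j.1) j.2

/-- The presentation of a functor conjugated by restrictions. -/
noncomputable def Presentation.conjPull {J' I' : Type} [SmallCategory J'] [SmallCategory I']
    {Φ : Rep k I ⥤ Rep k J} (p : Presentation Φ) (c : I ⥤ I') (c' : J' ⥤ J) :
    Presentation (pull k c ⋙ Φ ⋙ pull k c') where
  s := pull k c ⋙ p.s ⋙ pull k c'
  t := pull k c ⋙ p.t ⋙ pull k c'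
  s_additive :=
    ⟨fun {_ _ f g} => congrArg (pull k c').map
      (p.s.map_add (f := (pull k c).map f) (g := (pull k c).map g))⟩
  t_additive :=
    ⟨fun {_ _ f g} => congrArg (pull k c').map
      (p.t.map_add (f := (pull k c).map f) (g := (pull k c).map g))⟩
  s_exact S hS := pull_exact c' _ (p.s_exact _ (pull_exact c S hS))
  t_exact S hS := pull_exact c' _ (p.t_exact _ (pull_exact c S hS))
  θ := Functor.whiskerLeft (pull k c) (Functor.whiskerRight p.θ (pull k c'))
  π := Functor.whiskerLeft (pull k c) (Functor.whiskerRight p.π (pull k c'))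
  w X := NatTrans.ext (funext fun j =>
    congrArg (fun t => t.app (c'.obj j)) (p.w ((pull k c).obj X)))
  exact X := (exact_iff _).2 fun j => (exact_iff _).1 (p.exact ((pull k c).obj X)) (c'.obj j)
  epi X := (epi_iff _).2 fun j => (epi_iff _).1 (p.epi ((pull k c).obj X)) (c'.obj j)

lemma Presentation.conjPull_acyclic {J' I' : Type} [SmallCategory J'] [SmallCategory I']
    {Φ : Rep k I ⥤ Rep k J} (p : Presentation Φ) (c : I ⥤ I') (c' : J' ⥤ J) (X : Rep k I')
    (hX : p.Acyclic ((pull k c).obj X)) : (p.conjPull c c').Acyclic X :=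
  (mono_iff _).2 fun j => (mono_iff _).1 hX (c'.obj j)

/-- The presentation of `Φ × Id` induced by a presentation of `Φ`. -/
noncomputable def Presentation.inFst (E : Type) [SmallCategory E] {Φ : Rep k I ⥤ Rep k J}
    (p : Presentation Φ) : Presentation (inFst k E Φ) :=
  (p.inSnd E).conjPull (CategoryTheory.Prod.swap E I) (CategoryTheory.Prod.swap J E)

lemma InjectiveAction.slice {X : Rep k (E × I)} (hX : InjectiveAction X) (e : E) :
    InjectiveAction ((Functor.curry.obj X).obj e) :=
  fun _ _ f => hX (Prod.mkHom (𝟙 e) f)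

lemma InjectiveAction.pull {X : Rep k I} (hX : InjectiveAction X) (c : J ⥤ I) :
    InjectiveAction ((pull k c).obj X) :=
  fun _ _ f => hX (c.map f)

end InSnd

/-! ### Passage to bounded derived categories -/

section Bounded

variable {k : Type u} [Field k] {I J : Type} [SmallCategory I] [SmallCategory J]
  {M : ObjectProperty (Rep k I)}

open DerivedCategory

lemma DerivedData.exists_isLeftDerived {F : Rep k I ⥤ Rep k J} [F.Additive] (d : DerivedData F M)
    (r : Resolution M) : ∃ G, IsLeftDerived F G :=
  ⟨TStructure.t.bounded.lift (Bounded.ι ⋙ d.L) fun X => d.bounded _ X.property,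
    d.L, d.α, d.isLeftDerivedFunctor r, ⟨Iso.refl _⟩⟩

/-- By uniqueness of left derived functors, an arbitrary choice of `G` can be exchanged for the
explicit model `d.L`. Claims about all choices thereby reduce to the models. -/
lemma IsLeftDerived.nonempty_iso {F : Rep k I ⥤ Rep k J} [F.Additive] {G : Db k I ⥤ Db k J}
    (h : IsLeftDerived F G) (d : DerivedData F M) (r : Resolution M) :
    Nonempty (G ⋙ Bounded.ι ≅ Bounded.ι ⋙ d.L) := by
  obtain ⟨L, α, hL, ⟨e⟩⟩ := h
  have := d.isLeftDerivedFunctor r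
  exact ⟨e ≪≫ Functor.isoWhiskerLeft Bounded.ι (Functor.leftDerivedUnique d.L L α d.α
    (HomologicalComplex.quasiIso (Rep k I) (.up ℤ)))⟩

lemma DerivedData.exists_isTranslation {F : Rep k I ⥤ Rep k I} [F.Additive] (d : DerivedData F M)
    (r : Resolution M) : ∃ τ, IsTranslation F τ := by
  obtain ⟨G, hG⟩ := d.exists_isLeftDerived r
  exact ⟨_, G, hG, ⟨Iso.refl _⟩⟩

lemma IsTranslation.nonempty_iso {F : Rep k I ⥤ Rep k I} [F.Additive] {τ : Db k I ⥤ Db k I}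
    (h : IsTranslation F τ) (d : DerivedData F M) (r : Resolution M) :
    Nonempty (τ ⋙ Bounded.ι ≅ Bounded.ι ⋙ d.L ⋙ shiftFunctor _ (-1 : ℤ)) := by
  obtain ⟨G, hG, ⟨e⟩⟩ := h
  obtain ⟨e'⟩ := hG.nonempty_iso d r
  exact ⟨Functor.isoWhiskerRight e Bounded.ι ≪≫
    Functor.isoWhiskerLeft G (Bounded.ι.commShiftIso (-1 : ℤ)) ≪≫
    Functor.isoWhiskerRight e' (shiftFunctor _ (-1 : ℤ))⟩

lemma IsLeftDerived.nonempty_iso_single [M.IsClosedUnderIsomorphisms] {F : Rep k I ⥤ Rep k J}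
    [F.Additive] {G : Db k I ⥤ Db k J} (h : IsLeftDerived F G) (d : DerivedData F M)
    (r : Resolution M) (hM : ∀ X, IsZero X → M X) (X : Rep k I) (hX : M X) :
    Nonempty (G.obj (inDegreeZero X) ≅ inDegreeZero (F.obj X)) := by
  obtain ⟨e⟩ := h.nonempty_iso d r
  exact ⟨Bounded.ι.preimageIso (e.app (inDegreeZero X) ≪≫ d.singleIso hM X hX)⟩

end Bounded

end TypeA

namespace TypeA

open TensorProduct

/-! ### Tensor products by elements -/

section Tensor

variable {k : Type u} [Field k] {I J : Type} [SmallCategory I] [FinCategory I] [SmallCategory J]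

/-- The class of `x ⊗ b` in `(X ⊗_I B)(j)`. -/
noncomputable def tmk (B : Rep k (Iᵒᵖ × J)) (X : Rep k I) {i : I} {j : J} (x : X.obj i)
    (b : B.obj (op i, j)) : ((tensorFunctor B).obj X).obj j :=
  (coend.ι (integrand (Functor.curry.obj B) X j) i).hom.hom (x ⊗ₜ[k] b)

variable (B : Rep k (Iᵒᵖ × J)) (X : Rep k I)

lemma tmk_add {i : I} {j : J} (x x' : X.obj i) (b : B.obj (op i, j)) :
    tmk B X (x + x') b = tmk B X x b + tmk B X x' b := by
  rw [tmk, TensorProduct.add_tmul]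
  exact map_add _ _ _

lemma tmk_smul_left (c : k) {i : I} {j : J} (x : X.obj i) (b : B.obj (op i, j)) :
    tmk B X (c • x) b = c • tmk B X x b := by
  rw [tmk, ← TensorProduct.smul_tmul']
  exact map_smul _ _ _

lemma tmk_smul_right (c : k) {i : I} {j : J} (x : X.obj i) (b : B.obj (op i, j)) :
    tmk B X x (c • b) = c • tmk B X x b := by
  rw [tmk, TensorProduct.tmul_smul]
  exact map_smul _ _ _

lemma tmk_zero {i : I} {j : J} (x : X.obj i) : tmk B X x (0 : B.obj (op i, j)) = 0 := by
  rw [tmk, TensorProduct.tmul_zero]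
  exact map_zero _

lemma tmk_act {i i' : I} {j : J} (f : i ⟶ i') (x : X.obj i) (b : B.obj (op i', j)) :
    tmk B X x (act B (Prod.mkHom f.op (𝟙 j)) b) = tmk B X (act X f x) b :=
  congrArg (fun t => t.hom.hom (x ⊗ₜ[k] b))
    (coend.condition (integrand (Functor.curry.obj B) X j) f)

lemma act_tmk {i : I} {j j' : J} (g : j ⟶ j') (x : X.obj i) (b : B.obj (op i, j)) :
    act ((tensorFunctor B).obj X) g (tmk B X x b) =
      tmk B X x (act B (Prod.mkHom (𝟙 (op i)) g) b) :=
  congrArg (fun t => t.hom.hom (x ⊗ₜ[k] b))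
    (coend.ι_map (integrandMapRight (Functor.curry.obj B) X g) i)

lemma cmp_tmk {Y : Rep k I} (η : X ⟶ Y) {i : I} {j : J} (x : X.obj i) (b : B.obj (op i, j)) :
    cmp ((tensorFunctor B).map η) j (tmk B X x b) = tmk B Y (cmp η i x) b :=
  congrArg (fun t => t.hom.hom (x ⊗ₜ[k] b))
    (coend.ι_map (integrandMapLeft (Functor.curry.obj B) η j) i)

lemma tensor_hom_ext {j : J} {Z : FGModuleCat.{u} k}
    {g g' : ((tensorFunctor B).obj X).obj j ⟶ Z}
    (h : ∀ i (x : X.obj i) (b : B.obj (op i, j)),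
      g.hom.hom (tmk B X x b) = g'.hom.hom (tmk B X x b)) : g = g' :=
  coend.hom_ext fun i => FGModuleCat.hom_ext (TensorProduct.ext' fun x b => h i x b)

/-- Maps out of a tensor product. -/
lemma exists_tensor_desc {j : J} {Z : FGModuleCat.{u} k}
    (φ : ∀ i, X.obj i →ₗ[k] B.obj (op i, j) →ₗ[k] Z)
    (hφ : ∀ ⦃i i' : I⦄ (f : i ⟶ i') (x : X.obj i) (b : B.obj (op i', j)),
      φ i x (act B (Prod.mkHom f.op (𝟙 j)) b) = φ i' (act X f x) b) :
    ∃ g : ((tensorFunctor B).obj X).obj j ⟶ Z, ∀ i (x : X.obj i) (b : B.obj (op i, j)),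
      g.hom.hom (tmk B X x b) = φ i x b := by
  let ψ (i : I) : ((integrand (Functor.curry.obj B) X j).obj (op i)).obj i ⟶ Z :=
    FGModuleCat.ofHom (V := X.obj i ⊗[k] B.obj (op i, j)) (W := Z) (TensorProduct.lift (φ i))
  refine ⟨coend.desc ψ fun i i' f => FGModuleCat.hom_ext (TensorProduct.ext' fun x b => hφ f x b),
    fun i x b => ?_⟩
  exact congrArg (fun t => t.hom.hom (x ⊗ₜ[k] b)) (coend.ι_desc ψ _ i)

/-- Tensor products depend functorially on the bimodule. -/
noncomputable def tensorFunctorIso {B B' : Rep k (Iᵒᵖ × J)} (e : B ≅ B') :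
    tensorFunctor B ≅ tensorFunctor B' := by
  have h (B B' : Rep k (Iᵒᵖ × J)) (e : B ⟶ B') (X : Rep k I) (j : J) :=
    exists_tensor_desc B X (j := j) (Z := ((tensorFunctor B').obj X).obj j)
      (fun i => LinearMap.mk₂ k (fun x b => tmk B' X x (cmp e (op i, j) b))
        (fun x x' b => tmk_add B' X x x' _)
        (fun c x b => tmk_smul_left B' X c x _)
        (fun x b b' => by
          rw [map_add, tmk, TensorProduct.tmul_add]
          exact map_add _ _ _)
        (fun c x b => by rw [map_smul, tmk_smul_right]))
      (fun i i' f x b => by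
        rw [LinearMap.mk₂_apply, LinearMap.mk₂_apply, cmp_act, tmk_act])
  choose g hg using h
  simp only [LinearMap.mk₂_apply] at hg
  exact NatIso.ofComponents
    (fun X => NatIso.ofComponents
      (fun j =>
        { hom := g B B' e.hom X j
          inv := g B' B e.inv X j
          hom_inv_id := tensor_hom_ext B X fun i x b => by
            change (g B' B e.inv X j).hom.hom ((g B B' e.hom X j).hom.hom _) = tmk B X x b
            rw [hg, hg]
            exact congrArg (tmk B X x)
              (congrArg (fun t => cmp t (op i, j) b) e.hom_inv_id)
          inv_hom_id := tensor_hom_ext B' X fun i x b => by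
            change (g B B' e.hom X j).hom.hom ((g B' B e.inv X j).hom.hom _) = tmk B' X x b
            rw [hg, hg]
            exact congrArg (tmk B' X x)
              (congrArg (fun t => cmp t (op i, j) b) e.inv_hom_id) })
      (fun {j j'} f => tensor_hom_ext B X fun i x b => by
        change (g B B' e.hom X j').hom.hom (act ((tensorFunctor B).obj X) f _) =
          act ((tensorFunctor B').obj X) f ((g B B' e.hom X j).hom.hom _)
        rw [act_tmk, hg, hg, act_tmk, cmp_act]))
    (fun {X Y} η => NatTrans.ext (funext fun j => tensor_hom_ext B X fun i x b => by
      change (g B B' e.hom Y j).hom.hom (cmp ((tensorFunctor B).map η) j _) =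
        cmp ((tensorFunctor B').map η) j ((g B B' e.hom X j).hom.hom _)
      rw [cmp_tmk, hg, hg, cmp_tmk]))

end Tensor

/-! ### Tensoring with a standard bimodule -/

section Standard

variable {k : Type u} [Field k] {I J : Type} [SmallCategory I] [FinCategory I] [SmallCategory J]

/-- The generator of a standard module at a vertex of its support. -/
def stdOne (k : Type u) [Field k] {S : J → Prop}
    (hS : ∀ ⦃a b c : J⦄, (a ⟶ b) → (b ⟶ c) → S a → S c → S b)
    {i : J} (hi : S i) : (standardModule k S hS).obj i :=
  (⟨1, fun h => (h hi).elim⟩ : lineIf k (S i))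

/-- The coefficient of an element of a standard module. -/
def stdCoeff {S : J → Prop} (hS : ∀ ⦃a b c : J⦄, (a ⟶ b) → (b ⟶ c) → S a → S c → S b) (i : J) :
    (standardModule k S hS).obj i →ₗ[k] k :=
  (lineIf k (S i)).subtype

section

variable {S : J → Prop} {hS : ∀ ⦃a b c : J⦄, (a ⟶ b) → (b ⟶ c) → S a → S c → S b}

lemma std_eq_zero {i : J} (hi : ¬ S i) (x : (standardModule k S hS).obj i) : x = 0 :=
  Subtype.ext (Subtype.prop (p := (· ∈ lineIf k (S i))) x hi)

lemma stdCoeff_injective (i : J) : Function.Injective (stdCoeff (k := k) hS i) :=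
  Subtype.val_injective

lemma stdCoeff_stdOne {i : J} (hi : S i) : stdCoeff hS i (stdOne k hS hi) = 1 := rfl

lemma std_eq_smul {i : J} (hi : S i) (x : (standardModule k S hS).obj i) :
    x = stdCoeff hS i x • stdOne k hS hi :=
  stdCoeff_injective i (by rw [map_smul, stdCoeff_stdOne, smul_eq_mul, mul_one])

lemma stdCoeff_act {i j : J} (f : i ⟶ j) (x : (standardModule k S hS).obj i) (hj : S j) :
    stdCoeff hS j (act (standardModule k S hS) f x) = stdCoeff hS i x :=
  if_pos hj

lemma act_stdOne {i j : J} (f : i ⟶ j) (hi : S i) (hj : S j) :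
    act (standardModule k S hS) f (stdOne k hS hi) = stdOne k hS hj :=
  stdCoeff_injective j (by rw [stdCoeff_act _ _ hj, stdCoeff_stdOne, stdCoeff_stdOne])

end

variable (S : Iᵒᵖ × J → Prop)
  (hS : ∀ ⦃a b c : Iᵒᵖ × J⦄, (a ⟶ b) → (b ⟶ c) → S a → S c → S b) (d : J ⥤ I)

/-- The span of the images in `X(d j)` of the spaces `X(i)` such that `S` does not contain
`(i, j)`. -/
def relations (X : Rep k I) (j : J) : Submodule k (X.obj (d.obj j)) :=
  ⨆ (i : I) (f : i ⟶ d.obj j) (_ : ¬ S (op i, j)), LinearMap.range (act X f)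

variable (hd : ∀ j, S (op (d.obj j), j))

/-- The map sending `x` in `X(d j)` to `x ⊗ 1`, for a standard bimodule whose support contains all
pairs `(d j, j)`. -/
noncomputable def tensorStandardπ : pull k d ⟶ tensorFunctor (standardModule k S hS) where
  app X :=
    { app := fun j => FGModuleCat.ofHom
        { toFun := fun x => tmk (standardModule k S hS) X x (stdOne k hS (hd j))
          map_add' := fun _ _ => tmk_add _ _ _ _ _
          map_smul' := fun _ _ => tmk_smul_left _ _ _ _ _ }
      naturality := fun j j' g => FGModuleCat.hom_ext (LinearMap.ext fun x => by
        change tmk _ X (act X (d.map g) x) (stdOne k hS (hd j')) =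
          act ((tensorFunctor _).obj X) g (tmk _ X x (stdOne k hS (hd j)))
        rw [act_tmk, ← tmk_act]
        rfl) }
  naturality X Y η := by
    refine NatTrans.ext (funext fun j => FGModuleCat.hom_ext (LinearMap.ext fun x => ?_))
    exact (cmp_tmk _ X η x (stdOne k hS (hd j))).symm

lemma tensorStandardπ_apply (X : Rep k I) (j : J) (x : X.obj (d.obj j)) :
    cmp ((tensorStandardπ S hS d hd).app X) j x =
      tmk (standardModule k S hS) X x (stdOne k hS (hd j)) := rfl

/-- Every `b` over the support is a scalar multiple of the generator at `(d j, j)` moved along a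
path `f : i ⟶ d j`, so `x ⊗ b` is a multiple of `x f ⊗ 1`. Outside the support `b` is zero. -/
lemma tensorStandardπ_surjective (hle : ∀ i j, S (op i, j) → Nonempty (i ⟶ d.obj j)) (X : Rep k I)
    (j : J) : Function.Surjective (cmp ((tensorStandardπ S hS d hd).app X) j) := by
  -- Surjectivity is tested as an epimorphism because maps out of the tensor product are determined
  -- by pure tensors.
  rw [← fgModuleCat_epi_iff]
  refine ⟨fun g g' h => tensor_hom_ext _ X fun i x b => ?_⟩
  by_cases hi : S (op i, j)
  · obtain ⟨f⟩ := hle i j hi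
    have hb : b = stdCoeff hS _ b •
        act (standardModule k S hS) (Prod.mkHom f.op (𝟙 j)) (stdOne k hS (hd j)) := by
      rw [act_stdOne _ _ hi]
      exact std_eq_smul hi b
    rw [hb, tmk_smul_right, tmk_act, map_smul, map_smul]
    exact congrArg (stdCoeff hS _ b • ·) (congrArg (fun t => t.hom.hom (act X f x)) h)
  · rw [std_eq_zero hi b, tmk_zero, map_zero, map_zero]

-- If `(i, j)` is outside the support, moving the generator there gives zero, so `x f ⊗ 1 = x ⊗ 0`.
-- There are no further relations: `x ⊗ b ↦ b · [x f]` is well defined with values in the quotient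
-- by `relations`, and it sends `y ⊗ 1` to the class of `y`.
open Classical in
lemma tensorStandardπ_eq_zero_iff [Quiver.IsThin I]
    (hle : ∀ i j, S (op i, j) → Nonempty (i ⟶ d.obj j)) (X : Rep k I)
    (j : J) (y : X.obj (d.obj j)) :
    cmp ((tensorStandardπ S hS d hd).app X) j y = 0 ↔ y ∈ relations S d X j := by
  constructor
  · intro h
    have hmem {i : I} (f : i ⟶ d.obj j) (hi : ¬ S (op i, j)) (x : X.obj i) :
        act X f x ∈ relations S d X j :=
      Submodule.mem_iSup_of_mem i (Submodule.mem_iSup_of_mem f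
        (Submodule.mem_iSup_of_mem hi ⟨x, rfl⟩))
    let Z : FGModuleCat.{u} k := FGModuleCat.of k (X.obj (d.obj j) ⧸ relations S d X j)
    let q : X.obj (d.obj j) →ₗ[k] Z := (relations S d X j).mkQ
    have hq {y : X.obj (d.obj j)} : q y = 0 ↔ y ∈ relations S d X j :=
      Submodule.Quotient.mk_eq_zero _
    let ψ (i : I) : X.obj i →ₗ[k] Z :=
      if h : Nonempty (i ⟶ d.obj j) then q ∘ₗ act X h.some else 0
    have hψ {i : I} (f : i ⟶ d.obj j) (x : X.obj i) : ψ i x = q (act X f x) := by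
      have h : Nonempty (i ⟶ d.obj j) := ⟨f⟩
      simp only [ψ]
      rw [dif_pos h, Subsingleton.elim h.some f]
      rfl
    obtain ⟨g, hg⟩ := exists_tensor_desc (standardModule k S hS) X (j := j) (Z := Z)
      (fun i => LinearMap.mk₂ k (fun x b => stdCoeff hS _ b • ψ i x)
        (fun x x' b => by rw [map_add, smul_add])
        (fun c x b => by rw [map_smul, smul_comm])
        (fun x b b' => by rw [map_add, add_smul])
        (fun c x b => by rw [map_smul, smul_assoc]))
      (fun i i' f x b => by
        rw [LinearMap.mk₂_apply, LinearMap.mk₂_apply]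
        by_cases hb : S (op i', j)
        · obtain ⟨f'⟩ := hle i' j hb
          rw [hψ f', act_act, hψ (f ≫ f')]
          -- When `(i, j)` is outside the support the two coefficients may differ, but the class
          -- they multiply is zero.
          by_cases hi : S (op i, j)
          · rw [stdCoeff_act _ _ hi]
          · rw [hq.2 (hmem _ hi x), smul_zero, smul_zero]
        · rw [std_eq_zero hb b, map_zero, map_zero, map_zero, zero_smul, zero_smul])
    have h1 := hg (d.obj j) y (stdOne k hS (hd j))
    rw [tensorStandardπ_apply] at h
    rw [h, map_zero, LinearMap.mk₂_apply, hψ (𝟙 _), act_id, stdCoeff_stdOne, one_smul] at h1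
    exact hq.1 h1.symm
  · intro hy
    have : relations S d X j ≤ LinearMap.ker (cmp ((tensorStandardπ S hS d hd).app X) j) := by
      refine iSup_le fun i => iSup_le fun f => iSup_le fun hi => ?_
      rintro _ ⟨x, rfl⟩
      rw [LinearMap.mem_ker, tensorStandardπ_apply, ← tmk_act, std_eq_zero hi (act _ _ _)]
      exact tmk_zero _ _ _
    exact this hy

/-- The dual of the path algebra of a thin category is a standard bimodule. -/
noncomputable def dualBimoduleIso [Quiver.IsThin I] {S : Iᵒᵖ × I → Prop}
    (hS : ∀ ⦃a b c : Iᵒᵖ × I⦄, (a ⟶ b) → (b ⟶ c) → S a → S c → S b)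
    (h : ∀ p, S p ↔ Nonempty (p.2 ⟶ p.1.unop)) : standardModule k S hS ≅ dualBimodule k I :=
  let η : standardModule k S hS ⟶ dualBimodule k I :=
    { app := fun p => FGModuleCat.ofHom (V := lineIf k (S p)) (W := (p.2 ⟶ p.1.unop) → k)
        { toFun := fun x _ => stdCoeff hS p x
          map_add' := fun _ _ => funext fun _ => map_add (stdCoeff hS p) _ _
          map_smul' := fun _ _ => funext fun _ => map_smul (stdCoeff hS p) _ _ }
      naturality := fun p q f => FGModuleCat.hom_ext (LinearMap.ext fun x => funext fun g =>
        stdCoeff_act f x ((h q).2 ⟨g⟩)) }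
  have : Mono η := (mono_iff η).2 fun p x y hxy => by
    by_cases hp : S p
    · exact stdCoeff_injective p (congrFun hxy ((h p).1 hp).some)
    · rw [std_eq_zero hp x, std_eq_zero hp y]
  have : Epi η := (epi_iff η).2 fun p (x : (p.2 ⟶ p.1.unop) → k) => by
    by_cases hp : S p
    · refine ⟨x ((h p).1 hp).some • stdOne k hS hp, funext fun g => ?_⟩
      rw [Subsingleton.elim ((h p).1 hp).some g]
      exact mul_one (x g)
    · exact ⟨0, funext fun g => (hp ((h p).2 ⟨g⟩)).elim⟩
  have : IsIso η := isIso_of_mono_of_epi η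
  asIso η

end Standard

end TypeA

namespace TypeA

/-! ### Representable bimodules and restriction -/

section Standard

variable {k : Type u} [Field k] {I J E : Type} [SmallCategory I] [SmallCategory J]
  [SmallCategory E]

/-- The tensor product with a bimodule whose value at `j` is represented by `d j`. -/
noncomputable def pullIsoTensor [FinCategory I] [Quiver.IsThin I] (S : Iᵒᵖ × J → Prop)
    (hS : ∀ ⦃a b c : Iᵒᵖ × J⦄, (a ⟶ b) → (b ⟶ c) → S a → S c → S b) (d : J ⥤ I)
    (h : ∀ i j, S (op i, j) ↔ Nonempty (i ⟶ d.obj j)) :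
    pull k d ≅ tensorFunctor (standardModule k S hS) :=
  have hd (j : J) : S (op (d.obj j), j) := (h _ _).2 ⟨𝟙 _⟩
  natIsoOfEpi (𝟙 _) (tensorStandardπ S hS d hd) (fun _ _ x => ⟨x, rfl⟩)
    (tensorStandardπ_surjective S hS d hd fun i j => (h i j).1) fun X j y => by
      -- Every vertex with a path to `d j` lies in the support, so nothing is divided out.
      have : relations S d X j = ⊥ := by
        simp only [relations, iSup_eq_bot]
        exact fun i f hi => (hi ((h i j).2 ⟨f⟩)).elim
      rw [tensorStandardπ_eq_zero_iff S hS d hd (fun i j => (h i j).1), this]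
      rfl

/-- The restriction of a standard module. -/
noncomputable def inSndPullStandardIso (c : J ⥤ I) (S : E × I → Prop)
    (hS : ∀ ⦃a b c : E × I⦄, (a ⟶ b) → (b ⟶ c) → S a → S c → S b)
    (S' : E × J → Prop)
    (hS' : ∀ ⦃a b c : E × J⦄, (a ⟶ b) → (b ⟶ c) → S' a → S' c → S' b)
    (h : ∀ p, S' p ↔ S (p.1, c.obj p.2)) :
    standardModule k S' hS' ≅ (inSnd k E (pull k c)).obj (standardModule k S hS) := by
  obtain rfl : S' = fun p => S (p.1, c.obj p.2) := funext fun p => propext (h p)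
  refine NatIso.ofComponents (fun p => Iso.refl _) fun {p q} f => ?_
  refine FGModuleCat.hom_ext (LinearMap.ext fun x => ?_)
  have hact : act ((inSnd k E (pull k c)).obj (standardModule k S hS)) f x =
      act (standardModule k S hS) (Prod.mkHom f.1 (c.map f.2)) x :=
    (act_act (standardModule k S hS) (Prod.mkHom f.1 (𝟙 (c.obj p.2)))
      (Prod.mkHom (𝟙 q.1) (c.map f.2)) x).trans (congrArg (fun t => act (standardModule k S hS) t x)
        (Prod.ext (Category.comp_id _) (Category.id_comp _)))
  exact Eq.trans rfl hact.symm

end Standard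

/-! ### The Nakayama functor as a quotient of the last value -/

section TopQuotient

variable {k : Type u} [Field k] {a : ℕ} (ha : 1 ≤ a)

/-- The last vertex. -/
def topVtx : Vtx a := ⟨a, ha, le_rfl⟩

/-- The path to the last vertex. -/
def toTop (i : Vtx a) : i ⟶ topVtx ha := homOfLE i.2.2

/-- The span of the images of the values of a representation at the vertices before `j`. -/
def below (X : Rep k (Vtx a)) (j : Vtx a) : Submodule k (X.obj (topVtx ha)) :=
  ⨆ (i : Vtx a) (_ : i < j), LinearMap.range (act X (toTop ha i))

variable {ha} in
lemma mem_below {X : Rep k (Vtx a)} {i j : Vtx a} (h : i < j) (x : X.obj i) :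
    act X (toTop ha i) x ∈ below ha X j :=
  Submodule.mem_iSup_of_mem i (Submodule.mem_iSup_of_mem h ⟨x, rfl⟩)

/-- The constant functor to the last vertex. -/
abbrev constTop : Vtx a ⥤ Vtx a := (Functor.const (Vtx a)).obj (topVtx ha)

/-- A functor which sends `X` to the quotient of the constant representation on the value of `X`
at the last vertex by the images of the previous values. -/
structure TopQuotient (F : Rep k (Vtx a) ⥤ Rep k (Vtx a)) where
  /-- the projection -/
  π : pull k (constTop ha) ⟶ F
  surjective (X : Rep k (Vtx a)) (j : Vtx a) : Function.Surjective (cmp (π.app X) j)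
  ker (X : Rep k (Vtx a)) (j : Vtx a) (y : X.obj (topVtx ha)) :
    cmp (π.app X) j y = 0 ↔ y ∈ below ha X j

/-- The tensor product with `N`. -/
noncomputable def topQuotientTensor : TopQuotient ha (tensorFunctor (moduleN k a)) where
  π := tensorStandardπ _ _ (constTop ha) fun j => j.2.2
  surjective X j := tensorStandardπ_surjective _ _ (constTop ha) _ (fun i _ _ => ⟨toTop ha i⟩) X j
  ker X j y := by
    have : relations (fun p : (Vtx a)ᵒᵖ × Vtx a => p.2 ≤ p.1.unop) (constTop ha) X j =
        below ha X j := by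
      refine le_antisymm (iSup_le fun i => iSup_le fun f => iSup_le fun hi => ?_)
        (iSup_le fun i => iSup_le fun hi => ?_)
      · rintro _ ⟨x, rfl⟩
        exact mem_below (not_le.1 hi) x
      · rintro _ ⟨x, rfl⟩
        exact Submodule.mem_iSup_of_mem i (Submodule.mem_iSup_of_mem (toTop ha i)
          (Submodule.mem_iSup_of_mem hi.not_ge ⟨x, rfl⟩))
    rw [← this]
    exact tensorStandardπ_eq_zero_iff _ _ (constTop ha) _ (fun i _ _ => ⟨toTop ha i⟩) X j y

/-- The tensor product with `N` is the Nakayama functor. -/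
noncomputable def nakayamaIso (k : Type u) [Field k] (a : ℕ) :
    tensorFunctor (moduleN k a) ≅ nakayama k (Vtx a) :=
  tensorFunctorIso (dualBimoduleIso _ fun _ => ⟨fun h => ⟨homOfLE h⟩, fun ⟨f⟩ => leOfHom f⟩)

namespace TopQuotient

variable {ha} {F : Rep k (Vtx a) ⥤ Rep k (Vtx a)}

/-- Transport along an isomorphism. -/
noncomputable def ofIso {F' : Rep k (Vtx a) ⥤ Rep k (Vtx a)} (q : TopQuotient ha F) (e : F ≅ F') :
    TopQuotient ha F' where
  π := q.π ≫ e.hom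
  surjective X j := by
    have h := (epi_iff (e.hom.app X)).1 inferInstance j
    exact h.comp (q.surjective X j)
  ker X j y := by
    have h := (mono_iff (e.hom.app X)).1 inferInstance j
    rw [← q.ker]
    exact map_eq_zero_iff (cmp (e.hom.app X) j) h

/-- The previous vertex. -/
def pred (a : ℕ) : Vtx a ⥤ Vtx a :=
  -- The maximum sends the first vertex to itself; the resulting spurious value is removed by the
  -- cutoff in `predFunctor`.
  Monotone.functor (f := fun j => (⟨max (j.1 - 1) 1, le_max_right _ _,
    max_le ((Nat.sub_le _ _).trans j.2.2) (j.2.1.trans j.2.2)⟩ : Vtx a))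
    fun i j h => max_le_max (Nat.sub_le_sub_right (show i.1 ≤ j.1 from h) 1) le_rfl

lemma one_lt_of_hom ⦃i j : Vtx a⦄ (f : i ⟶ j) (h : 1 < i.1) : 1 < j.1 :=
  h.trans_le (leOfHom f)

/-- The value at the previous vertex, or zero. -/
noncomputable def predFunctor (k : Type u) [Field k] (a : ℕ) : Rep k (Vtx a) ⥤ Rep k (Vtx a) :=
  pull k (pred a) ⋙ cutoff k (fun j => 1 < j.1) one_lt_of_hom

instance : (predFunctor k a).Additive := by
  unfold predFunctor
  infer_instance

/-- The map from the value at the previous vertex to the value at the last one. -/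
noncomputable def predFunctorι : predFunctor k a ⟶ pull k (constTop ha) :=
  Functor.whiskerLeft (pull k (pred a)) (cutoffι _ one_lt_of_hom) ≫
    (Functor.whiskeringLeft _ _ (FGModuleCat.{u} k)).map
      { app := fun j => toTop ha ((pred a).obj j) }

/-- Every path from a vertex `i < j` to the last vertex passes through `j - 1`, so the image of that
single space is the whole span. This lets an exact functor of `X` carry the relations. -/
lemma predFunctorι_range (X : Rep k (Vtx a)) (j : Vtx a) (y : X.obj (topVtx ha)) :
    y ∈ below ha X j ↔ ∃ x, cmp ((predFunctorι (k := k) (ha := ha)).app X) j x = y := by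
  constructor
  · intro hy
    have : below ha X j ≤ LinearMap.range (cmp ((predFunctorι (k := k) (ha := ha)).app X) j) := by
      refine iSup_le fun i => iSup_le fun hi => ?_
      rintro _ ⟨x, rfl⟩
      have hi' : i.1 < j.1 := hi
      have hj : 1 < j.1 := lt_of_le_of_lt i.2.1 hi'
      have hle : i ≤ (pred a).obj j := le_max_of_le_left (Nat.le_sub_one_of_lt hi')
      exact ⟨⟨act X (homOfLE hle) x, fun h => (h hj).elim⟩, act_act X _ _ x⟩
    exact this hy
  · rintro ⟨⟨x, hx⟩, rfl⟩
    by_cases hj : 1 < j.1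
    · refine mem_below (i := (pred a).obj j) ?_ x
      exact max_lt (Nat.sub_lt (by lia) one_pos) hj
    · obtain rfl : x = 0 := hx hj
      exact (congrArg (· ∈ below ha X j) (map_zero (act X (toTop ha ((pred a).obj j))))).mpr
        (zero_mem _)

/-- The resolution of the quotient by exact functors. -/
noncomputable def presentation (q : TopQuotient ha F) : Presentation F where
  s := predFunctor k a
  t := pull k (constTop ha)
  s_exact S hS := cutoff_exact _ one_lt_of_hom _ (pull_exact (pred a) S hS)
  t_exact S hS := pull_exact (constTop ha) S hS
  θ := predFunctorι
  π := q.π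
  w X := NatTrans.ext (funext fun j => FGModuleCat.hom_ext (LinearMap.ext fun x =>
    (q.ker X j _).2 ((predFunctorι_range X j _).2 ⟨x, rfl⟩)))
  exact X := (exact_iff _).2 fun j y h => (predFunctorι_range X j y).1 ((q.ker X j y).1 h)
  epi X := (epi_iff _).2 (q.surjective X)

lemma acyclic_of_injective (q : TopQuotient ha F) (X : Rep k (Vtx a))
    (hX : ∀ i, Function.Injective (act X (toTop ha i))) : q.presentation.Acyclic X :=
  (mono_iff _).2 fun j => (hX ((pred a).obj j)).comp
    (cutoffι_injective _ one_lt_of_hom ((pull k (pred a)).obj X) j)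

end TopQuotient

end TopQuotient

end TypeA

namespace TypeA

/-! ### Comparison of the two quotients for interlaced maps -/

section Comparison

variable {k : Type u} [Field k] {l m n : ℕ} {hl : 1 ≤ l} {hm : 1 ≤ m} {hn : 1 ≤ n}

/-- Two functors `c₁ : A_m × A_n ⥤ A_l` and `c₂ : A_n × A_m ⥤ A_l` such that the vertices
strictly before `c₁ (μ, ν)` are those which are at most `c₂ (ν', m)` with `ν' < ν` or at most
`c₂ (n, μ')` with `μ' < μ`. -/
structure Interlaced (hl : 1 ≤ l) (hm : 1 ≤ m) (hn : 1 ≤ n) (c₁ : Vtx m × Vtx n ⥤ Vtx l)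
    (c₂ : Vtx n × Vtx m ⥤ Vtx l) : Prop where
  top : topVtx hl ≤ c₂.obj (topVtx hn, topVtx hm)
  left_lt (μ : Vtx m) {ν' ν : Vtx n} (h : ν' < ν) : c₂.obj (ν', topVtx hm) < c₁.obj (μ, ν)
  right_lt (ν : Vtx n) {μ' μ : Vtx m} (h : μ' < μ) : c₂.obj (topVtx hn, μ') < c₁.obj (μ, ν)
  exists_le {μ : Vtx m} {ν : Vtx n} {i : Vtx l} (h : i < c₁.obj (μ, ν)) :
    (∃ ν' < ν, i ≤ c₂.obj (ν', topVtx hm)) ∨ ∃ μ' < μ, i ≤ c₂.obj (topVtx hn, μ')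
  -- This plays no role in comparing the quotients; it serves the acyclicity statement
  -- `acyclic_inFst`.
  const {ν' : Vtx n} (h : ν' < topVtx hn) (μ : Vtx m) : c₂.obj (ν', topVtx hm) ≤ c₂.obj (ν', μ)

variable {F : Rep k (Vtx m) ⥤ Rep k (Vtx m)} {G : Rep k (Vtx n) ⥤ Rep k (Vtx n)}
  {H : Rep k (Vtx l) ⥤ Rep k (Vtx l)} (f : TopQuotient hm F) (g : TopQuotient hn G)
  (q : TopQuotient hl H)

/-- The span of the images of the spaces `Y(ν', m)` in `Y(n, m)` for `ν' < ν`. -/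
def belowFst (hm : 1 ≤ m) (hn : 1 ≤ n) (Y : Rep k (Vtx n × Vtx m)) (ν : Vtx n) :
    Submodule k (Y.obj (topVtx hn, topVtx hm)) :=
  ⨆ (ν' : Vtx n) (_ : ν' < ν), LinearMap.range (act Y (Prod.mkHom (toTop hn ν') (𝟙 (topVtx hm))))

/-- The span of the images of the spaces `Y(e, μ')` in `Y(e, m)` for `μ' < μ`. -/
def belowSnd (hm : 1 ≤ m) (Y : Rep k (Vtx n × Vtx m)) (e : Vtx n) (μ : Vtx m) :
    Submodule k (Y.obj (e, topVtx hm)) :=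
  ⨆ (μ' : Vtx m) (_ : μ' < μ), LinearMap.range (act Y (Prod.mkHom (𝟙 e) (toTop hm μ')))

/-- The projection onto `F` in the second variable. -/
def sndπ (Y : Rep k (Vtx n × Vtx m)) (e : Vtx n) (μ : Vtx m) :
    Y.obj (e, topVtx hm) →ₗ[k] ((inSnd k (Vtx n) F).obj Y).obj (e, μ) :=
  cmp (f.π.app ((Functor.curry.obj Y).obj e)) μ

lemma sndπ_surjective (Y : Rep k (Vtx n × Vtx m)) (e : Vtx n) (μ : Vtx m) :
    Function.Surjective (sndπ f Y e μ) := f.surjective _ _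

lemma sndπ_eq_zero_iff (Y : Rep k (Vtx n × Vtx m)) (e : Vtx n) (μ : Vtx m)
    (y : Y.obj (e, topVtx hm)) : sndπ f Y e μ y = 0 ↔ y ∈ belowSnd hm Y e μ :=
  f.ker ((Functor.curry.obj Y).obj e) μ y

lemma sndπ_act (Y : Rep k (Vtx n × Vtx m)) {e e' : Vtx n} (t : e ⟶ e') (μ : Vtx m)
    (y : Y.obj (e, topVtx hm)) :
    sndπ f Y e' μ (act Y (Prod.mkHom t (𝟙 (topVtx hm))) y) =
      act ((inSnd k (Vtx n) F).obj Y) (Prod.mkHom t (𝟙 μ)) (sndπ f Y e μ y) := by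
  have h := cmp_act ((inSndMap (Vtx n) f.π).app Y) (Prod.mkHom t (𝟙 μ)) y
  refine Eq.trans (congrArg (sndπ f Y e' μ) ?_) h
  exact (act_act Y (Prod.mkHom t (𝟙 (topVtx hm))) (Prod.mkHom (𝟙 e') (𝟙 (topVtx hm))) y).symm

/-- The value of the flip of a representation in the second variable. -/
abbrev column (Z : Rep k (Vtx n × Vtx m)) (μ : Vtx m) : Rep k (Vtx n) :=
  (Functor.curry.obj ((exchangeFactors k (Vtx n) (Vtx m)).obj Z)).obj μ

/-- The composition of `F` in the second variable and `G` in the first variable, up to the flip. -/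
abbrev bothFactors (F : Rep k (Vtx m) ⥤ Rep k (Vtx m)) (G : Rep k (Vtx n) ⥤ Rep k (Vtx n)) :
    Rep k (Vtx n × Vtx m) ⥤ Rep k (Vtx m × Vtx n) :=
  inSnd k (Vtx n) F ⋙ inFst k (Vtx m) G ⋙ exchangeFactors k (Vtx n) (Vtx m)

/-- The projection onto the composition of both quotients. -/
def bothπ : bothFactors (pull k (constTop hm)) (pull k (constTop hn)) ⟶ bothFactors F G :=
  Functor.whiskerRight (inSndMap (Vtx n) f.π)
      (inFst k (Vtx m) (pull k (constTop hn)) ⋙ exchangeFactors k (Vtx n) (Vtx m)) ≫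
    Functor.whiskerLeft (inSnd k (Vtx n) F) (Functor.whiskerRight
      (Functor.whiskerLeft (exchangeFactors k (Vtx n) (Vtx m))
        (Functor.whiskerRight (inSndMap (Vtx m) g.π) (exchangeFactors k (Vtx m) (Vtx n))))
      (exchangeFactors k (Vtx n) (Vtx m)))

lemma bothπ_surjective (Y : Rep k (Vtx n × Vtx m)) (p : Vtx m × Vtx n) :
    Function.Surjective (cmp ((bothπ f g).app Y) p) := fun z => by
  obtain ⟨w, hw⟩ := g.surjective (column ((inSnd k (Vtx n) F).obj Y) p.1) p.2 z
  obtain ⟨y, rfl⟩ := sndπ_surjective f Y (topVtx hn) p.1 w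
  exact ⟨y, hw⟩

/-- The first quotient has kernel `belowSnd`. Since it is surjective also at each `ν' < ν`, what the
second one kills is the image of `belowFst`, and the preimage of an image is the sum with the
kernel. -/
lemma bothπ_eq_zero_iff (Y : Rep k (Vtx n × Vtx m)) (μ : Vtx m) (ν : Vtx n)
    (y : Y.obj (topVtx hn, topVtx hm)) :
    cmp ((bothπ f g).app Y) (μ, ν) y = 0 ↔
      y ∈ belowFst hm hn Y ν ⊔ belowSnd hm Y (topVtx hn) μ := by
  have hker : LinearMap.ker (sndπ f Y (topVtx hn) μ) = belowSnd hm Y (topVtx hn) μ :=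
    Submodule.ext fun y => sndπ_eq_zero_iff f Y _ μ y
  have hmap : below hn (column ((inSnd k (Vtx n) F).obj Y) μ) ν =
      (belowFst hm hn Y ν).map (sndπ f Y (topVtx hn) μ) := by
    simp only [below, belowFst, Submodule.map_iSup]
    refine iSup_congr fun ν' => iSup_congr fun _ => ?_
    ext z
    constructor
    · rintro ⟨w, rfl⟩
      obtain ⟨x, rfl⟩ := sndπ_surjective f Y ν' μ w
      exact ⟨_, ⟨x, rfl⟩, sndπ_act f Y (toTop hn ν') μ x⟩
    · rintro ⟨_, ⟨x, rfl⟩, rfl⟩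
      exact ⟨sndπ f Y ν' μ x, (sndπ_act f Y (toTop hn ν') μ x).symm⟩
  refine (g.ker (column ((inSnd k (Vtx n) F).obj Y) μ) ν (sndπ f Y (topVtx hn) μ y)).trans
    ((Iff.of_eq (congrArg (fun U => sndπ f Y (topVtx hn) μ y ∈ U) hmap)).trans ?_)
  rw [← hker, ← Submodule.comap_map_eq]
  rfl

variable {c₁ : Vtx m × Vtx n ⥤ Vtx l} {c₂ : Vtx n × Vtx m ⥤ Vtx l}

/-- The comparison of the values at the last vertices. -/
def topComparison (hl : 1 ≤ l) (hm : 1 ≤ m) (hn : 1 ≤ n) (c₁ : Vtx m × Vtx n ⥤ Vtx l)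
    (c₂ : Vtx n × Vtx m ⥤ Vtx l) :
    pull k c₂ ⋙ bothFactors (pull k (constTop hm)) (pull k (constTop hn)) ⟶
      pull k (constTop hl) ⋙ pull k c₁ where
  app X :=
    { app := fun p => X.map (toTop hl (c₂.obj (topVtx hn, topVtx hm)))
      naturality := fun p p' t => FGModuleCat.hom_ext (LinearMap.ext fun x => by
        -- All transition maps of the constant representations come from endomorphisms of one
        -- vertex, which are identities by thinness.
        have hid (b : (topVtx hn, topVtx hm) ⟶ (topVtx hn, topVtx hm))
            (x : X.obj (c₂.obj (topVtx hn, topVtx hm))) : act X (c₂.map b) x = x := by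
          rw [Subsingleton.elim (c₂.map b) (𝟙 _), act_id]
        refine Eq.trans ?_ (act_id X _ _).symm
        refine congrArg (act X (toTop hl (c₂.obj (topVtx hn, topVtx hm)))) ?_
        change act X (c₂.map _) (act X (c₂.map _) (act X (c₂.map _) (act X (c₂.map _) x))) = x
        exact (hid _ _).trans ((hid _ _).trans ((hid _ _).trans (hid _ _)))) }
  naturality X X' η := NatTrans.ext (funext fun p => (η.naturality _).symm)

/-- Images in `X(l)` grow with the vertex, so mutually cofinal families of vertices span the same
subspace. The field `exists_le` gives one inclusion, `left_lt` and `right_lt` the other, and `top`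
inverts the map from `X(c₂(n, m))` to `X(l)`. -/
lemma act_toTop_mem_below_iff (hc : Interlaced hl hm hn c₁ c₂) (X : Rep k (Vtx l)) (μ : Vtx m)
    (ν : Vtx n) (y : X.obj (c₂.obj (topVtx hn, topVtx hm))) :
    act X (toTop hl _) y ∈ below hl X (c₁.obj (μ, ν)) ↔
      y ∈ belowFst hm hn ((pull k c₂).obj X) ν ⊔ belowSnd hm ((pull k c₂).obj X) (topVtx hn) μ := by
  have hinv : act X (homOfLE hc.top) (act X (toTop hl _) y) = y := by
    rw [act_act, Subsingleton.elim (_ ≫ _) (𝟙 _), act_id]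
  have h₁ : below hl X (c₁.obj (μ, ν)) ≤ (belowFst hm hn ((pull k c₂).obj X) ν ⊔
      belowSnd hm ((pull k c₂).obj X) (topVtx hn) μ).comap (act X (homOfLE hc.top)) := by
    refine iSup_le fun i => iSup_le fun hi => ?_
    rintro _ ⟨x, rfl⟩
    rw [Submodule.mem_comap, act_act]
    obtain ⟨ν', hν, hi⟩ | ⟨μ', hμ, hi⟩ := hc.exists_le hi
    · refine Submodule.mem_sup_left (Submodule.mem_iSup_of_mem ν'
        (Submodule.mem_iSup_of_mem hν ⟨act X (homOfLE hi) x, ?_⟩))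
      exact (act_act X _ (c₂.map (Prod.mkHom (toTop hn ν') (𝟙 (topVtx hm)))) x).trans
        (congrArg (fun t => act X t x) (Subsingleton.elim _ _))
    · refine Submodule.mem_sup_right (Submodule.mem_iSup_of_mem μ'
        (Submodule.mem_iSup_of_mem hμ ⟨act X (homOfLE hi) x, ?_⟩))
      exact (act_act X _ (c₂.map (Prod.mkHom (𝟙 (topVtx hn)) (toTop hm μ'))) x).trans
        (congrArg (fun t => act X t x) (Subsingleton.elim _ _))
  have h₂ : belowFst hm hn ((pull k c₂).obj X) ν ⊔
      belowSnd hm ((pull k c₂).obj X) (topVtx hn) μ ≤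
        (below hl X (c₁.obj (μ, ν))).comap (act X (toTop hl _)) := by
    refine sup_le (iSup_le fun ν' => iSup_le fun hν => ?_)
      (iSup_le fun μ' => iSup_le fun hμ => ?_)
    · rintro _ ⟨x, rfl⟩
      have := mem_below (ha := hl) (hc.left_lt μ hν) x
      rw [Submodule.mem_comap]
      convert this using 1
      exact (act_act X (c₂.map (Prod.mkHom (toTop hn ν') (𝟙 (topVtx hm)))) _ x).trans
        (congrArg (fun t => act X t x) (Subsingleton.elim _ _))
    · rintro _ ⟨x, rfl⟩
      have := mem_below (ha := hl) (hc.right_lt ν hμ) x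
      rw [Submodule.mem_comap]
      convert this using 1
      exact (act_act X (c₂.map (Prod.mkHom (𝟙 (topVtx hn)) (toTop hm μ'))) _ x).trans
        (congrArg (fun t => act X t x) (Subsingleton.elim _ _))
  exact ⟨fun h => by simpa only [Submodule.mem_comap, hinv] using h₁ h, fun h => h₂ h⟩

/-- The comparison of quotients: `c₁^* ∘ H ≅ (flip) ∘ G ∘ F ∘ c₂^*`. -/
noncomputable def interlacedIso (hc : Interlaced hl hm hn c₁ c₂) :
    H ⋙ pull k c₁ ≅ pull k c₂ ⋙ bothFactors F G :=
  natIsoOfEpi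
    (topComparison hl hm hn c₁ c₂ ≫ Functor.whiskerRight q.π (pull k c₁))
    (Functor.whiskerLeft (pull k c₂) (bothπ f g))
    (fun X p z => by
      obtain ⟨y, hy⟩ := q.surjective X (c₁.obj p) z
      refine ⟨act X (homOfLE hc.top) y, ?_⟩
      change cmp (q.π.app X) (c₁.obj p) (act X (toTop hl _) (act X (homOfLE hc.top) y)) = z
      rw [act_act, ← hy, Subsingleton.elim (_ ≫ _) (𝟙 _), act_id])
    (fun X p => bothπ_surjective f g ((pull k c₂).obj X) p)
    (fun X p y => (q.ker X (c₁.obj p) _).trans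
      ((act_toTop_mem_below_iff hc X p.1 p.2 y).trans
        (bothπ_eq_zero_iff f g ((pull k c₂).obj X) p.1 p.2 y).symm))

/-- If all paths act injectively on `X`, then `F ∘ c₂^*` sends `X` to a representation which is
acyclic in the first variable. -/
lemma acyclic_inFst (f : TopQuotient hm F) (g : TopQuotient hn G)
    (hc : Interlaced hl hm hn c₁ c₂) (X : Rep k (Vtx l))
    (hX : InjectiveAction X) :
    (g.presentation.inFst (Vtx m)).Acyclic ((inSnd k (Vtx n) F).obj ((pull k c₂).obj X)) := by
  refine Presentation.conjPull_acyclic _ _ _ _ (Presentation.inSnd_acyclic _ _ fun μ => ?_)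
  refine g.acyclic_of_injective _ fun ν' => ?_
  obtain rfl | hν : ν' = topVtx hn ∨ ν' < topVtx hn := eq_or_lt_of_le ν'.2.2
  · rw [Subsingleton.elim (toTop hn _) (𝟙 _)]
    intro x y h
    rwa [act_id, act_id] at h
  · rw [← LinearMap.ker_eq_bot, LinearMap.ker_eq_bot']
    intro w hw
    obtain ⟨x, rfl⟩ := sndπ_surjective f ((pull k c₂).obj X) ν' μ w
    have h := (sndπ_act f ((pull k c₂).obj X) (toTop hn ν') μ x).trans hw
    rw [sndπ_eq_zero_iff] at h ⊢
    -- By `const`, the value at `(ν', μ')` already fills the value at `(ν', m)`. If `μ` has a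
    -- predecessor, the quotient at `(ν', μ)` is therefore zero. Otherwise nothing is divided out,
    -- and injectivity is that of the action on `X`.
    by_cases hμ : ∃ μ' : Vtx m, μ' < μ
    · obtain ⟨μ', hμ⟩ := hμ
      refine Submodule.mem_iSup_of_mem μ' (Submodule.mem_iSup_of_mem hμ
        ⟨act X (homOfLE (hc.const hν μ')) x, ?_⟩)
      refine (act_act X _ (c₂.map (Prod.mkHom (𝟙 ν') (toTop hm μ'))) x).trans ?_
      rw [Subsingleton.elim (_ ≫ _) (𝟙 _), act_id]
    · have hbot (e : Vtx n) : belowSnd hm ((pull k c₂).obj X) e μ = ⊥ := by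
        simp only [belowSnd, iSup_eq_bot]
        exact fun μ' h => (hμ ⟨μ', h⟩).elim
      rw [hbot, Submodule.mem_bot] at h ⊢
      exact hX _ (h.trans (map_zero _).symm)

end Comparison

end TypeA

namespace TypeA

/-! ### Height functions and fiber-reversals of the supports -/

section Supports

variable {l m n : ℕ}

/-- The largest `γ` such that `(γ, μ, ν)` belongs to `S_{m;1}^n`. -/
def heightFirst (h : l = m + n - 1) : Vtx m × Vtx n ⥤ Vtx l where
  obj p := ⟨if p.1.1 = 1 then p.2.1 else p.1.1 + n - 1, by
    obtain ⟨⟨μ, h₁, h₂⟩, ν, h₃, h₄⟩ := p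
    dsimp only
    split_ifs <;> constructor <;> omega⟩
  map {p q} f := homOfLE <| by
    obtain ⟨⟨μ, h₁, h₂⟩, ν, h₃, h₄⟩ := p
    obtain ⟨⟨μ', h₁', h₂'⟩, ν', h₃', h₄'⟩ := q
    have hμ : μ ≤ μ' := leOfHom f.1
    have hν : ν ≤ ν' := leOfHom f.2
    rw [Subtype.mk_le_mk]
    dsimp only
    split_ifs <;> omega

/-- The largest `γ` such that `(γ, ν, μ)` belongs to `S_{n;n}^m`. -/
def heightLast (h : l = n + m - 1) : Vtx n × Vtx m ⥤ Vtx l where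
  obj p := ⟨if p.1.1 < n then p.1.1 else n + p.2.1 - 1, by
    obtain ⟨⟨ν, h₁, h₂⟩, μ, h₃, h₄⟩ := p
    dsimp only
    split_ifs <;> constructor <;> omega⟩
  map {p q} f := homOfLE <| by
    obtain ⟨⟨ν, h₁, h₂⟩, μ, h₃, h₄⟩ := p
    obtain ⟨⟨ν', h₁', h₂'⟩, μ', h₃', h₄'⟩ := q
    have hν : ν ≤ ν' := leOfHom f.1
    have hμ : μ ≤ μ' := leOfHom f.2
    rw [Subtype.mk_le_mk]
    dsimp only
    split_ifs <;> omega

lemma mem_supportSet_first (h : l = m + n - 1) (p : (Vtx l)ᵒᵖ × (Vtx m × Vtx n)) :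
    triple p ∈ supportSet m 1 n ↔ p.1.unop ≤ (heightFirst h).obj p.2 := by
  subst h
  obtain ⟨⟨⟨c, hc⟩⟩, ⟨b, hb⟩, ⟨a, ha⟩⟩ := p
  change _ ↔ c ≤ if b = 1 then a else b + n - 1
  rw [Set.mem_Icc] at hc hb ha
  simp only [supportSet, box, sides, triple, Set.mem_ofPred_eq, Fin.forall_fin_succ,
    Matrix.cons_val, Fin.succ_zero_eq_one, Fin.succ_one_eq_two]
  split_ifs <;> simp_all
  omega

lemma mem_supportSet_last (h : l = n + m - 1) (p : (Vtx l)ᵒᵖ × (Vtx n × Vtx m)) :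
    triple p ∈ supportSet n n m ↔ p.1.unop ≤ (heightLast h).obj p.2 := by
  subst h
  obtain ⟨⟨⟨c, hc⟩⟩, ⟨b, hb⟩, ⟨a, ha⟩⟩ := p
  change _ ↔ c ≤ if b < n then b else n + a - 1
  rw [Set.mem_Icc] at hc hb ha
  simp only [supportSet, box, sides, triple, Set.mem_ofPred_eq, Fin.forall_fin_succ,
    Matrix.cons_val, Fin.succ_zero_eq_one, Fin.succ_one_eq_two]
  split_ifs <;> simp_all <;> omega

lemma interlaced (hl : 1 ≤ l) (hm : 1 ≤ m) (hn : 1 ≤ n) (h : l = m + n - 1) (h' : l = n + m - 1) :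
    Interlaced hl hm hn (heightFirst h) (heightLast h') where
  top := by
    change l ≤ if n < n then n else n + m - 1
    split_ifs <;> omega
  left_lt := fun ⟨μ, hμ⟩ ⟨ν', hν'⟩ ⟨ν, hν⟩ hlt => by
    rw [Subtype.mk_lt_mk] at hlt
    change (if ν' < n then ν' else n + m - 1) < if μ = 1 then ν else μ + n - 1
    rw [Set.mem_Icc] at hμ hν hν'
    split_ifs <;> omega
  right_lt := fun ⟨ν, hν⟩ ⟨μ', hμ'⟩ ⟨μ, hμ⟩ hlt => by
    rw [Subtype.mk_lt_mk] at hlt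
    change (if n < n then n else n + μ' - 1) < if μ = 1 then ν else μ + n - 1
    rw [Set.mem_Icc] at hμ hν hμ'
    split_ifs <;> omega
  exists_le := fun {μ ν i} hi => by
    obtain ⟨μ, hμ⟩ := μ
    obtain ⟨ν, hν⟩ := ν
    obtain ⟨i, hi'⟩ := i
    rw [Set.mem_Icc] at hμ hν hi'
    replace hi : i < if μ = 1 then ν else μ + n - 1 := hi
    by_cases h₁ : μ = 1
    · rw [if_pos h₁] at hi
      -- Here `c₁(1, ν) = ν`, so `i < ν ≤ n` gives `c₂(i, m) = i`, and `i` itself is the witness.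
      refine Or.inl ⟨⟨i, hi'.1, by omega⟩, hi, ?_⟩
      change i ≤ if i < n then i else n + m - 1
      split_ifs <;> omega
    · rw [if_neg h₁] at hi
      -- Here `i ≤ μ + n - 2`, which is exactly `c₂(n, μ - 1)`.
      refine Or.inr ⟨⟨μ - 1, by omega, by omega⟩, Nat.sub_lt hμ.1 one_pos, ?_⟩
      change i ≤ if n < n then n else n + (μ - 1) - 1
      split_ifs <;> omega
  const := fun {ν'} hν μ => by
    replace hν : ν'.1 < n := hν
    change (if ν'.1 < n then ν'.1 else n + m - 1) ≤ if ν'.1 < n then ν'.1 else n + μ.1 - 1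
    rw [if_pos hν, if_pos hν]

lemma forall_fin_three {P : Fin 3 → Prop} : (∀ i, P i) ↔ P 0 ∧ P 1 ∧ P 2 := by
  simp [Fin.forall_fin_succ]

lemma mem_supportSet {m i n : ℕ} (p : Fin 3 → ℕ) : p ∈ supportSet m i n ↔
    ((1 ≤ p 0 ∧ p 0 ≤ m + n - 1) ∧ (1 ≤ p 1 ∧ p 1 ≤ m) ∧ (1 ≤ p 2 ∧ p 2 ≤ n)) ∧
    ((p 1 ≤ i - 1 ∧ p 0 ≤ p 1) ∨ (p 1 = i ∧ p 0 ≤ i + p 2 - 1) ∨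
      (i + 1 ≤ p 1 ∧ p 0 ≤ p 1 + n - 1)) := by
  simp [supportSet, box, sides, forall_fin_three]

lemma mem_box_sides {m n : ℕ} (p : Fin 3 → ℕ) : p ∈ box (sides m n) ↔
    (1 ≤ p 0 ∧ p 0 ≤ m + n - 1) ∧ (1 ≤ p 1 ∧ p 1 ≤ m) ∧ (1 ≤ p 2 ∧ p 2 ≤ n) := by
  simp [box, sides, forall_fin_three]

lemma injectiveInDirection_supportSet (m i n : ℕ) :
    InjectiveInDirection (sides m n) 0 (supportSet m i n) := by
  refine ⟨fun p hp => hp.1, fun p hp γ h₁ h₂ => ?_⟩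
  rw [mem_supportSet] at hp ⊢
  simp only [Function.update_self, ne_eq, Fin.reduceEq, not_false_eq_true, Function.update_of_ne]
  omega

lemma projectiveInDirection_supportSet (m i n : ℕ) :
    ProjectiveInDirection (sides m n) 2 (supportSet m i n) := by
  refine ⟨fun p hp => hp.1, fun p hp γ h₁ (h₂ : γ ≤ n) => ?_⟩
  rw [mem_supportSet] at hp ⊢
  simp only [Function.update_self, ne_eq, Fin.reduceEq, not_false_eq_true, Function.update_of_ne]
  omega

/-- The first fiber-reversal of `S_{n;n}^m`. -/
lemma mem_reverseProjective_supportSet (n m : ℕ) (p : Fin 3 → ℕ) :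
    p ∈ reverseProjective (sides n m) 2 (supportSet n n m) ↔
      p ∈ box (sides n m) ∧ ((p 1 < n ∧ p 0 ≤ p 1 ∧ p 2 = 1) ∨
        (p 1 = n ∧ (p 2 = 1 ∨ n + p 2 - 1 ≤ p 0))) := by
  simp only [reverseProjective, Set.mem_ofPred_eq, mem_supportSet, mem_box_sides,
    Function.update_self, ne_eq, Fin.reduceEq, not_false_eq_true, Function.update_of_ne]
  constructor
  · rintro ⟨h₁, ⟨γ, h₂⟩, h₃⟩
    omega
  · rintro ⟨h₁, h₂⟩
    -- A nonempty fiber of a projective set contains its last point, here `m`.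
    refine ⟨h₁, ⟨m, ?_⟩, ?_⟩ <;> omega

lemma projectiveInDirection_reverseProjective (n m : ℕ) :
    ProjectiveInDirection (sides n m) 1
      (reverseProjective (sides n m) 2 (supportSet n n m)) := by
  refine ⟨fun p hp => hp.1, fun p hp γ h₁ (h₂ : γ ≤ n) => ?_⟩
  rw [mem_reverseProjective_supportSet, mem_box_sides] at hp ⊢
  simp only [Function.update_self, ne_eq, Fin.reduceEq, not_false_eq_true, Function.update_of_ne]
  omega

/-- Both sides describe `γ ≥ c₁(μ, ν)`. On the right, for `μ = 1` the fiber in the direction of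
length `n` is `[min(γ, n), n]`, whose reversal is `ν ≤ γ`. For `μ > 1` that fiber is `{n}` if `μ + n
- 1 ≤ γ` and empty otherwise, and `{n}` reverses to all of `[1, n]`. -/
lemma reverseInjective_supportSet (m n : ℕ) :
    reverseInjective (sides m n) 0 (supportSet m 1 n) =
      swapLast ⁻¹' reverseProjective (sides n m) 1
        (reverseProjective (sides n m) 2 (supportSet n n m)) := by
  ext p
  rw [Set.mem_preimage, reverseProjective.eq_def _ 1]
  simp only [reverseInjective, Set.mem_ofPred_eq, mem_supportSet,
    mem_reverseProjective_supportSet, mem_box_sides, swapLast,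
    Function.update_self, ne_eq, Fin.reduceEq, not_false_eq_true, Function.update_of_ne,
    Matrix.cons_val]
  constructor
  · rintro ⟨h₁, ⟨γ, h₂⟩, h₃⟩
    refine ⟨by omega, ⟨n, ?_⟩, ?_⟩ <;> omega
  · rintro ⟨h₁, ⟨γ, h₂⟩, h₃⟩
    -- A nonempty fiber of an injective set contains its first point.
    refine ⟨by omega, ⟨1, ?_⟩, ?_⟩ <;> omega

end Supports

end TypeA

namespace TypeA

/-! ### Finiteness and thinness of product quivers -/

section Products

variable (I J : Type) [SmallCategory I] [SmallCategory J]

/-- Free covers, and hence the resolutions, are also needed over `A_m × A_n` and `A_l^op × A_m ×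
A_n`. -/
noncomputable instance [FinCategory I] [FinCategory J] : FinCategory (I × J) where
  fintypeObj := inferInstance
  fintypeHom p q := Fintype.ofInjective (β := (p.1 ⟶ q.1) × (p.2 ⟶ q.2))
    (fun f => (f.1, f.2)) fun _ _ h => Prod.ext (congrArg (·.1) h) (congrArg (·.2) h)

instance [Quiver.IsThin I] [Quiver.IsThin J] : Quiver.IsThin (I × J) := fun _ _ =>
  ⟨fun _ _ => Prod.ext (Subsingleton.elim _ _) (Subsingleton.elim _ _)⟩

end Products

/-! ### Injective action implies acyclicity -/

section Acyclic

variable {k : Type u} [Field k] {E E' : Type} [SmallCategory E] [SmallCategory E'] {a : ℕ}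
  {ha : 1 ≤ a} {F : Rep k (Vtx a) ⥤ Rep k (Vtx a)}

/-- A resolution by objects with a property is a resolution by objects with a weaker property. -/
def Resolution.ofLE {A : Type*} [Category* A] [Abelian A] {M M' : ObjectProperty A}
    (r : Resolution M) (h : M ≤ M') : Resolution M' where
  P := r.P
  p := r.p
  quasiIso := r.quasiIso
  mem K i := h _ (r.mem K i)

lemma TopQuotient.injectiveAction_le (q : TopQuotient ha F) :
    InjectiveAction ≤ q.presentation.Acyclic :=
  fun X hX => q.acyclic_of_injective X fun _ => hX _

lemma Presentation.injectiveAction_le_inSnd {I J : Type} [SmallCategory I] [SmallCategory J]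
    {Φ : Rep k I ⥤ Rep k J} (p : Presentation Φ) (hp : InjectiveAction ≤ p.Acyclic) :
    InjectiveAction ≤ (p.inSnd E).Acyclic :=
  fun X hX => p.inSnd_acyclic X fun e => hp _ (hX.slice e)

lemma Presentation.injectiveAction_le_inFst {I J : Type} [SmallCategory I] [SmallCategory J]
    {Φ : Rep k I ⥤ Rep k J} (p : Presentation Φ) (hp : InjectiveAction ≤ p.Acyclic) :
    InjectiveAction ≤ (p.inFst E).Acyclic :=
  fun X hX => Presentation.conjPull_acyclic _ _ _ X
    (p.injectiveAction_le_inSnd hp _ (hX.pull _))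

end Acyclic

/-! ### Derived data of the functors in the theorem -/

section Nabla

variable {k : Type u} [Field k] {l m n : ℕ}

/-- The functor `∇_{m;1}^n` is a restriction. -/
noncomputable def nablaFirstIso (h : l = m + n - 1) : pull k (heightFirst h) ≅ nabla k l m 1 n h :=
  pullIsoTensor _ _ _ fun i j => (mem_supportSet_first h (op i, j)).trans
    ⟨fun h => ⟨homOfLE h⟩, fun ⟨f⟩ => leOfHom f⟩

/-- The functor `∇_{n;n}^m` is a restriction. -/
noncomputable def nablaLastIso (h : l = n + m - 1) : pull k (heightLast h) ≅ nabla k l n n m h :=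
  pullIsoTensor _ _ _ fun i j => (mem_supportSet_last h (op i, j)).trans
    ⟨fun h => ⟨homOfLE h⟩, fun ⟨f⟩ => leOfHom f⟩

/-- The derived functor of `∇_{m;1}^n`. -/
noncomputable def nablaFirstData (h : l = m + n - 1) : DerivedData (nabla k l m 1 n h) ⊤ :=
  (DerivedData.ofExact _ (pull_exact _)).ofIso (nablaFirstIso h)

/-- The derived functor of `∇_{n;n}^m`. -/
noncomputable def nablaLastData (h : l = n + m - 1) : DerivedData (nabla k l n n m h) ⊤ :=
  (DerivedData.ofExact _ (pull_exact _)).ofIso (nablaLastIso h)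

/-- The derived functor of `Id × ∇_{m;1}^n`. -/
noncomputable def inSndNablaFirstData (E : Type) [SmallCategory E] (h : l = m + n - 1) :
    DerivedData (inSnd k E (nabla k l m 1 n h)) ⊤ :=
  (DerivedData.ofExact _ (inSnd_exact _ (pull_exact _))).ofIso (inSndIso E (nablaFirstIso h))

/-- The derived functor of the flip. -/
noncomputable def exchangeData (k : Type u) [Field k] (I J : Type) [SmallCategory I]
    [SmallCategory J] : DerivedData (exchangeFactors k I J) ⊤ :=
  DerivedData.ofExact _ (pull_exact _)

/-- The derived functor of `Id` times the flip. -/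
noncomputable def inSndExchangeData (k : Type u) [Field k] (E I J : Type) [SmallCategory E]
    [SmallCategory I] [SmallCategory J] : DerivedData (inSnd k E (exchangeFactors k I J)) ⊤ :=
  DerivedData.ofExact _ (inSnd_exact _ (pull_exact _))

/-- A functorial resolution without condition on the terms. -/
noncomputable def resolutionTop (k : Type u) [Field k] (J : Type) [SmallCategory J] [FinCategory J]
    [Quiver.IsThin J] : Resolution (⊤ : ObjectProperty (Rep k J)) :=
  injectiveActionResolution.ofLE le_top

/-- The underived Nakayama functor as a quotient. -/
noncomputable def topQuotientNakayama {a : ℕ} (ha : 1 ≤ a) :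
    TopQuotient ha (nakayama k (Vtx a)) :=
  (topQuotientTensor ha).ofIso (nakayamaIso k a)

end Nabla

/-! ### Existence of the derived functors -/

section Existence

/-- The functors `∇` and the flip are restrictions up to isomorphism, hence exact. For the others
the cone of the presentation is a left derived functor, since resolutions with injective action are
acyclic for it. -/
lemma exists_derived (k : Type u) [Field k] (l m n : ℕ) (hm : 1 ≤ m) (hn : 1 ≤ n)
    (h : l = m + n - 1) (h' : l = n + m - 1) :
    ((∃ T, IsLeftDerived (inSnd k (Vtx l)ᵒᵖ (nabla k l m 1 n h)) T) ∧
      (∃ T, IsLeftDerived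
        (inSnd k (Vtx l)ᵒᵖ (inSnd k (Vtx n) (tensorFunctor (moduleN k m)))) T) ∧
      (∃ T, IsLeftDerived
        (inSnd k (Vtx l)ᵒᵖ (inFst k (Vtx m) (tensorFunctor (moduleN k n)))) T) ∧
      (∃ T, IsLeftDerived (inSnd k (Vtx l)ᵒᵖ (exchangeFactors k (Vtx n) (Vtx m))) T) ∧
      (∃ D, IsLeftDerived (nabla k l m 1 n h) D) ∧
      (∃ D, IsLeftDerived (nabla k l n n m h') D) ∧
      (∃ X, IsLeftDerived (exchangeFactors k (Vtx n) (Vtx m)) X) ∧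
      (∃ τ, IsTranslation (nakayama k (Vtx l)) τ) ∧
      (∃ τ, IsTranslation (inFst k (Vtx m) (nakayama k (Vtx n))) τ) ∧
      (∃ τ, IsTranslation (inSnd k (Vtx n) (nakayama k (Vtx m))) τ)) := by
  have hl : 1 ≤ l := by omega
  have hle {a : ℕ} (ha : 1 ≤ a) := (topQuotientTensor (k := k) ha).injectiveAction_le
  have hle' {a : ℕ} (ha : 1 ≤ a) := (topQuotientNakayama (k := k) ha).injectiveAction_le
  exact ⟨(inSndNablaFirstData _ h).exists_isLeftDerived (resolutionTop _ _),
    ((((topQuotientTensor hm).presentation.inSnd _).inSnd _).derivedData).exists_isLeftDerived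
      (injectiveActionResolution.ofLE (Presentation.injectiveAction_le_inSnd _
        (Presentation.injectiveAction_le_inSnd _ (hle hm)))),
    ((((topQuotientTensor hn).presentation.inFst _).inSnd _).derivedData).exists_isLeftDerived
      (injectiveActionResolution.ofLE (Presentation.injectiveAction_le_inSnd _
        (Presentation.injectiveAction_le_inFst _ (hle hn)))),
    (inSndExchangeData _ _ _ _).exists_isLeftDerived (resolutionTop _ _),
    (nablaFirstData h).exists_isLeftDerived (resolutionTop _ _),
    (nablaLastData h').exists_isLeftDerived (resolutionTop _ _),
    (exchangeData _ _ _).exists_isLeftDerived (resolutionTop _ _),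
    (topQuotientNakayama hl).presentation.derivedData.exists_isTranslation
      (injectiveActionResolution.ofLE (hle' hl)),
    ((topQuotientNakayama hn).presentation.inFst _).derivedData.exists_isTranslation
      (injectiveActionResolution.ofLE (Presentation.injectiveAction_le_inFst _ (hle' hn))),
    ((topQuotientNakayama hm).presentation.inSnd _).derivedData.exists_isTranslation
      (injectiveActionResolution.ofLE (Presentation.injectiveAction_le_inSnd _ (hle' hm)))⟩

end Existence

end TypeA

namespace TypeA

/-! ### The isomorphism of bimodules -/

section Bimodules

variable {k : Type u} [Field k]

section Standard

variable {I : Type} [SmallCategory I] {S S' : I → Prop}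

lemma injective_act_standardModule
    (hS : ∀ ⦃a b c : I⦄, (a ⟶ b) → (b ⟶ c) → S a → S c → S b) {i j : I} (f : i ⟶ j)
    (h : S i → S j) : Function.Injective (act (standardModule k S hS) f) := fun x y hxy => by
  by_cases hi : S i
  · refine stdCoeff_injective i ?_
    rw [← stdCoeff_act f x (h hi), hxy, stdCoeff_act f y (h hi)]
  · rw [std_eq_zero hi x, std_eq_zero hi y]

lemma surjective_act_standardModule
    (hS : ∀ ⦃a b c : I⦄, (a ⟶ b) → (b ⟶ c) → S a → S c → S b) {i j : I} (f : i ⟶ j)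
    (h : S j → S i) : Function.Surjective (act (standardModule k S hS) f) := fun y => by
  by_cases hj : S j
  · exact ⟨stdCoeff hS j y • stdOne k hS (h hj), by
      rw [map_smul, act_stdOne _ _ hj, ← std_eq_smul]⟩
  · exact ⟨0, by rw [std_eq_zero hj y, map_zero]⟩

lemma injectiveAction_standardModule {E : Type} [SmallCategory E] {S : E × I → Prop}
    (hS : ∀ ⦃a b c : E × I⦄, (a ⟶ b) → (b ⟶ c) → S a → S c → S b)
    (h : ∀ ⦃p q : E × I⦄, (p ⟶ q) → S p → S q) (e : E) :
    InjectiveAction ((Functor.curry.obj (standardModule k S hS)).obj e) :=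
  fun i j f => injective_act_standardModule hS (i := (e, i)) (j := (e, j))
    (Prod.mkHom (𝟙 e) f) (h (Prod.mkHom (𝟙 e) f))

/-- The projection of a standard module onto another one. -/
noncomputable def standardDesc (hS : ∀ ⦃a b c : I⦄, (a ⟶ b) → (b ⟶ c) → S a → S c → S b)
    (hS' : ∀ ⦃a b c : I⦄, (a ⟶ b) → (b ⟶ c) → S' a → S' c → S' b) (h : ∀ i, S' i → S i)
    (h' : ∀ ⦃i j⦄, (i ⟶ j) → S' j → S i → S' i) :
    standardModule k S hS ⟶ standardModule k S' hS' where
  app i := FGModuleCat.ofHom (lineIfMap k (S i) (S' i))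
  naturality i j f := FGModuleCat.hom_ext (LinearMap.ext fun x =>
    stdCoeff_injective (hS := hS') j (by
    classical
    change (if S' j then (if S j then stdCoeff hS i x else 0) else 0) =
      if S' j then (if S' i then stdCoeff hS i x else 0) else 0
    by_cases hj : S' j
    · by_cases hi : S i
      · simp [hj, h j hj, h' f hj hi]
      · rw [std_eq_zero hi x, map_zero]
        simp
    · simp [hj]))

lemma stdCoeff_standardDesc (hS : ∀ ⦃a b c : I⦄, (a ⟶ b) → (b ⟶ c) → S a → S c → S b)
    (hS' : ∀ ⦃a b c : I⦄, (a ⟶ b) → (b ⟶ c) → S' a → S' c → S' b) (h : ∀ i, S' i → S i)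
    (h' : ∀ ⦃i j⦄, (i ⟶ j) → S' j → S i → S' i) {i : I} (hi : S' i)
    (x : (standardModule k S hS).obj i) :
    stdCoeff hS' i (cmp (standardDesc hS hS' h h') i x) = stdCoeff hS i x :=
  if_pos hi

lemma standardDesc_surjective (hS : ∀ ⦃a b c : I⦄, (a ⟶ b) → (b ⟶ c) → S a → S c → S b)
    (hS' : ∀ ⦃a b c : I⦄, (a ⟶ b) → (b ⟶ c) → S' a → S' c → S' b) (h : ∀ i, S' i → S i)
    (h' : ∀ ⦃i j⦄, (i ⟶ j) → S' j → S i → S' i) (i : I) :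
    Function.Surjective (cmp (standardDesc (k := k) hS hS' h h') i) := fun y => by
  by_cases hi : S' i
  · exact ⟨stdCoeff hS' i y • stdOne k hS (h i hi), stdCoeff_injective i (by
      rw [stdCoeff_standardDesc _ _ _ _ hi, map_smul, stdCoeff_stdOne, smul_eq_mul, mul_one])⟩
  · exact ⟨0, by rw [std_eq_zero hi y, map_zero]⟩

lemma standardDesc_injective (hS : ∀ ⦃a b c : I⦄, (a ⟶ b) → (b ⟶ c) → S a → S c → S b)
    (hS' : ∀ ⦃a b c : I⦄, (a ⟶ b) → (b ⟶ c) → S' a → S' c → S' b) (h : ∀ i, S' i → S i)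
    (h' : ∀ ⦃i j⦄, (i ⟶ j) → S' j → S i → S' i) {i : I} (hi : S' i) :
    Function.Injective (cmp (standardDesc (k := k) hS hS' h h') i) := fun x y hxy =>
  stdCoeff_injective i (by
    rw [← stdCoeff_standardDesc hS hS' h h' hi x, hxy, stdCoeff_standardDesc hS hS' h h' hi y])

end Standard

lemma le_snd_convex {a : ℕ} ⦃p q r : (Vtx a)ᵒᵖ × Vtx a⦄ (f : p ⟶ q) (_ : q ⟶ r)
    (hp : p.1.unop ≤ p.2) (_ : r.1.unop ≤ r.2) : q.1.unop ≤ q.2 :=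
  (leOfHom f.1.unop).trans (hp.trans (leOfHom f.2))

lemma le_fst_convex {a : ℕ} ⦃p q r : (Vtx a)ᵒᵖ × Vtx a⦄ (_ : p ⟶ q) (g : q ⟶ r)
    (_ : p.2 ≤ p.1.unop) (hr : r.2 ≤ r.1.unop) : q.2 ≤ q.1.unop :=
  (leOfHom g.2).trans (hr.trans (leOfHom g.1.unop))

/-- The path algebra of `A_a` as a bimodule. -/
noncomputable def pathBimodule (k : Type u) [Field k] (a : ℕ) : Rep k ((Vtx a)ᵒᵖ × Vtx a) :=
  standardModule k _ (le_snd_convex (a := a))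

lemma injectiveAction_pathBimodule (a : ℕ) (e : (Vtx a)ᵒᵖ) :
    InjectiveAction ((Functor.curry.obj (pathBimodule k a)).obj e) :=
  injectiveAction_standardModule _
    (fun _ _ f h => (leOfHom f.1.unop).trans (h.trans (leOfHom f.2))) e

/-- The constant module with value `k`. -/
noncomputable def constModule (k : Type u) [Field k] {a : ℕ} (ha : 1 ≤ a) :
    Rep k ((Vtx a)ᵒᵖ × Vtx a) :=
  standardModule k (fun p => p.1.unop ≤ topVtx ha) fun _ b _ _ _ _ _ => b.1.unop.2.2

/-- The projection of the constant module onto `N_a`. -/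
noncomputable def constModuleDesc (k : Type u) [Field k] {a : ℕ} (ha : 1 ≤ a) :
    constModule k ha ⟶ moduleN k a :=
  standardDesc (fun _ b _ _ _ _ _ => b.1.unop.2.2) le_fst_convex (fun i _ => i.1.unop.2.2)
    (fun _ _ f h _ => (leOfHom f.2).trans (h.trans (leOfHom f.1.unop)))

/-- The constant module as a restriction of the path algebra. -/
noncomputable def constModuleIso (k : Type u) [Field k] {a : ℕ} (ha : 1 ≤ a) :
    constModule k ha ≅ (inSnd k (Vtx a)ᵒᵖ (pull k (constTop ha))).obj (pathBimodule k a) :=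
  inSndPullStandardIso _ _ _ _ _ fun _ => Iff.rfl

/-- The path algebra vanishes at `(i, i')` for `i' < j ≤ i`, so the Nakayama quotient keeps all of
`k` at `(i, j)`; this is the support of `N_a`. -/
lemma below_pathBimodule_eq_bot {a : ℕ} (ha : 1 ≤ a) {i : (Vtx a)ᵒᵖ} {j : Vtx a}
    (h : j ≤ i.unop) : below ha ((Functor.curry.obj (pathBimodule k a)).obj i) j = ⊥ := by
  simp only [below, iSup_eq_bot]
  intro i' hi
  rw [LinearMap.range_eq_bot]
  refine LinearMap.ext fun x => ?_
  have hx : x = 0 := std_eq_zero (hS := le_snd_convex) (i := (i, i')) (hi.trans_le h).not_ge x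
  rw [hx, map_zero, map_zero]

/-- For `i < j` the identity path at `i` generates the value at the last vertex, so the quotient is
zero, as outside the support of `N_a`. -/
lemma mem_below_pathBimodule {a : ℕ} (ha : 1 ≤ a) {i : (Vtx a)ᵒᵖ} {j : Vtx a} (h : ¬ j ≤ i.unop)
    (y : ((Functor.curry.obj (pathBimodule k a)).obj i).obj (topVtx ha)) :
    y ∈ below ha ((Functor.curry.obj (pathBimodule k a)).obj i) j := by
  obtain ⟨x, rfl⟩ := surjective_act_standardModule (k := k) le_snd_convex
    (i := (i, i.unop)) (j := (i, topVtx ha)) (Prod.mkHom (𝟙 i) (toTop ha i.unop))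
    (fun _ => le_refl i.unop) y
  exact mem_below (X := (Functor.curry.obj (pathBimodule k a)).obj i) (not_le.1 h) x

/-- The image of the path algebra under the Nakayama functor. -/
noncomputable def moduleNIso {a : ℕ} {ha : 1 ≤ a} {F : Rep k (Vtx a) ⥤ Rep k (Vtx a)}
    (q : TopQuotient ha F) :
    moduleN k a ≅ (inSnd k (Vtx a)ᵒᵖ F).obj (pathBimodule k a) :=
  isoOfEpi ((constModuleIso k ha).inv ≫ constModuleDesc k ha)
    ((inSndMap (Vtx a)ᵒᵖ q.π).app (pathBimodule k a))
    (fun j => Function.Surjective.comp (g := cmp (constModuleDesc k ha) j)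
      (standardDesc_surjective _ _ _ _ j) ((epi_iff (constModuleIso k ha).inv).1 inferInstance j))
    (fun j => q.surjective _ _)
    (fun j y => by
      refine Iff.trans ?_ (q.ker ((Functor.curry.obj (pathBimodule k a)).obj j.1) j.2 y).symm
      by_cases hj : j.2 ≤ j.1.unop
      · refine Iff.trans ?_ (Iff.of_eq (congrArg (y ∈ ·) (below_pathBimodule_eq_bot ha hj))).symm
        exact map_eq_zero_iff (cmp ((constModuleIso k ha).inv ≫ constModuleDesc k ha) j)
          (Function.Injective.comp (g := cmp (constModuleDesc k ha) j)
            (standardDesc_injective _ _ _ _ hj)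
            ((mono_iff (constModuleIso k ha).inv).1 inferInstance j))
      · exact iff_of_true (std_eq_zero (hS := le_fst_convex) (i := j) hj _)
          (mem_below_pathBimodule ha hj y))

variable {l m n : ℕ}

/-- The module `M_{n;n}^m` as a restriction of the path algebra. -/
noncomputable def moduleMLastIso (h : l = n + m - 1) : moduleM k l n n m h ≅
    (inSnd k (Vtx l)ᵒᵖ (pull k (heightLast h))).obj (pathBimodule k l) :=
  inSndPullStandardIso _ _ _ _ _ fun p => mem_supportSet_last h p

lemma injectiveAction_moduleM (i : ℕ) (h : l = m + n - 1) (e : (Vtx l)ᵒᵖ) :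
    InjectiveAction ((Functor.curry.obj (moduleM k l m i n h)).obj e) :=
  injectiveAction_standardModule _ (fun _ _ f => supportSet_closed l m i n h f) e

/-- The functor `Id × Φ` is computed pointwise in the first variable. -/
def inSndSliceIso {E I J : Type} [SmallCategory E] [SmallCategory I] [SmallCategory J]
    (Φ : Rep k I ⥤ Rep k J) (X : Rep k (E × I)) (e : E) :
    (Functor.curry.obj ((inSnd k E Φ).obj X)).obj e ≅ Φ.obj ((Functor.curry.obj X).obj e) :=
  (Functor.currying.unitIso.symm.app (Functor.curry.obj X ⋙ Φ)).app e

/-- An isomorphism of modules induces an isomorphism of objects of the derived category. -/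
noncomputable def inDegreeZeroIso {I : Type} [SmallCategory I] {X Y : Rep k I} (e : X ≅ Y) :
    inDegreeZero X ≅ inDegreeZero Y :=
  DerivedCategory.Bounded.ι.preimageIso ((DerivedCategory.singleFunctor (Rep k I) 0).mapIso e)

/-- Each module is acyclic for the next functor, so all derived functors may be replaced by
underived ones. What remains is `interlacedIso`, applied pointwise in `A_l^op` to the path algebra.
-/
lemma nonempty_iso_bimodules (hm : 1 ≤ m) (hn : 1 ≤ n) (h : l = m + n - 1) (h' : l = n + m - 1)
    {T₁ T₂ T₃ T₄}
    (h₁ : IsLeftDerived (inSnd k (Vtx l)ᵒᵖ (nabla k l m 1 n h)) T₁)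
    (h₂ : IsLeftDerived (inSnd k (Vtx l)ᵒᵖ (inSnd k (Vtx n) (tensorFunctor (moduleN k m)))) T₂)
    (h₃ : IsLeftDerived (inSnd k (Vtx l)ᵒᵖ (inFst k (Vtx m) (tensorFunctor (moduleN k n)))) T₃)
    (h₄ : IsLeftDerived (inSnd k (Vtx l)ᵒᵖ (exchangeFactors k (Vtx n) (Vtx m))) T₄) :
    Nonempty (T₁.obj (inDegreeZero (moduleN k l)) ≅
      T₄.obj (T₃.obj (T₂.obj (inDegreeZero (moduleM k l n n m h'))))) := by
  have hl : 1 ≤ l := by omega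
  let f := topQuotientTensor (k := k) hm
  let g := topQuotientTensor (k := k) hn
  let q := topQuotientTensor (k := k) hl
  let E := (Vtx l)ᵒᵖ
  let M := moduleM k l n n m h'
  let F := tensorFunctor (moduleN k m)
  let G := tensorFunctor (moduleN k n)
  let c₂ := heightLast h'
  obtain ⟨e₁⟩ := h₁.nonempty_iso_single (inSndNablaFirstData _ h) (resolutionTop _ _)
    (fun _ _ => trivial) (moduleN k l) trivial
  obtain ⟨e₂⟩ := h₂.nonempty_iso_single ((f.presentation.inSnd _).inSnd E).derivedData
    (injectiveActionResolution.ofLE (Presentation.injectiveAction_le_inSnd _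
        (Presentation.injectiveAction_le_inSnd _ f.injectiveAction_le)))
    (fun _ => Presentation.acyclic_of_isZero _) M
    (Presentation.inSnd_acyclic _ _ fun e => Presentation.injectiveAction_le_inSnd _
      f.injectiveAction_le _ (injectiveAction_moduleM _ _ e))
  obtain ⟨e₃⟩ := h₃.nonempty_iso_single ((g.presentation.inFst _).inSnd E).derivedData
    (injectiveActionResolution.ofLE (Presentation.injectiveAction_le_inSnd _
        (Presentation.injectiveAction_le_inFst _ g.injectiveAction_le)))
    (fun _ => Presentation.acyclic_of_isZero _) ((inSnd k E (inSnd k (Vtx n) F)).obj M)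
    -- For fixed `e`, `M` is the restriction along `c₂` of a slice of the path algebra, on which all
    -- paths act injectively; hence `acyclic_inFst` applies.
    (Presentation.inSnd_acyclic _ _ fun e => ObjectProperty.prop_of_iso _
      ((inSndSliceIso _ M e).trans ((inSnd k (Vtx n) F).mapIso
        (((Functor.curry.mapIso (moduleMLastIso h')).app e).trans
          (inSndSliceIso (pull k c₂) (pathBimodule k l) e)))).symm
      (acyclic_inFst f g (interlaced hl hm hn h h') _ (injectiveAction_pathBimodule l e)))
  obtain ⟨e₄⟩ := h₄.nonempty_iso_single (inSndExchangeData _ _ _ _) (resolutionTop _ _)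
    (fun _ _ => trivial)
    ((inSnd k E (inFst k (Vtx m) G)).obj ((inSnd k E (inSnd k (Vtx n) F)).obj M)) trivial
  let ε : inSnd k E (tensorFunctor (moduleN k l)) ⋙ inSnd k E (nabla k l m 1 n h) ≅
      inSnd k E (pull k c₂) ⋙ inSnd k E (inSnd k (Vtx n) F) ⋙ inSnd k E (inFst k (Vtx m) G) ⋙
        inSnd k E (exchangeFactors k (Vtx n) (Vtx m)) :=
    inSndComp E _ _ ≪≫ inSndIso E (Functor.isoWhiskerLeft _ (nablaFirstIso h).symm ≪≫
      interlacedIso f g q (interlaced hl hm hn h h')) ≪≫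
      (inSndComp E (pull k c₂) (bothFactors F G)).symm ≪≫
      Functor.isoWhiskerLeft (inSnd k E (pull k c₂))
        ((inSndComp E _ (inFst k (Vtx m) G ⋙ exchangeFactors k (Vtx n) (Vtx m))).symm ≪≫
          Functor.isoWhiskerLeft _ (inSndComp E _ _).symm)
  let ε' := inDegreeZeroIso ((inSnd k E (nabla k l m 1 n h)).mapIso (moduleNIso q) ≪≫
    ε.app (pathBimodule k l) ≪≫ (inSnd k E (inSnd k (Vtx n) F) ⋙ inSnd k E (inFst k (Vtx m) G) ⋙
        inSnd k E (exchangeFactors k (Vtx n) (Vtx m))).mapIso (moduleMLastIso h').symm)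
  exact ⟨e₁ ≪≫ ε' ≪≫ e₄.symm ≪≫ T₄.mapIso e₃.symm ≪≫ T₄.mapIso (T₃.mapIso e₂.symm)⟩

end Bimodules

end TypeA

namespace TypeA

/-! ### The isomorphism of functors with Auslander–Reiten translations -/

section Translation

variable {k : Type u} [Field k] {l m n : ℕ}

open DerivedCategory

/-- The derived functors of both sides of the comparison of Nakayama functors. -/
noncomputable def derivedNakayamaIso (hl : 1 ≤ l) (hm : 1 ≤ m) (hn : 1 ≤ n) (h : l = m + n - 1)
    (h' : l = n + m - 1) :
    (topQuotientNakayama (k := k) hl).presentation.derivedData.L ⋙ (nablaFirstData h).L ≅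
      (nablaLastData h').L ⋙
        ((topQuotientNakayama (k := k) hm).presentation.inSnd (Vtx n)).derivedData.L ⋙
        ((topQuotientNakayama (k := k) hn).presentation.inFst (Vtx m)).derivedData.L ⋙
        (exchangeData k (Vtx n) (Vtx m)).L :=
  let f := topQuotientNakayama (k := k) hm
  let g := topQuotientNakayama (k := k) hn
  let q := topQuotientNakayama (k := k) hl
  let e : nakayama k (Vtx l) ⋙ nabla k l m 1 n h ≅ nabla k l n n m h' ⋙
      inSnd k (Vtx n) (nakayama k (Vtx m)) ⋙ inFst k (Vtx m) (nakayama k (Vtx n)) ⋙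
        exchangeFactors k (Vtx n) (Vtx m) :=
    Functor.isoWhiskerLeft _ (nablaFirstIso h).symm ≪≫
      interlacedIso f g q (interlaced hl hm hn h h') ≪≫
      Functor.isoWhiskerRight (nablaLastIso h') (bothFactors _ _)
  -- On representations with injective action every factor of either composite is computed without
  -- deriving, so both composites are left derived functors of isomorphic functors.
  let d := ((q.presentation.derivedData.comp (nablaFirstData h)).restrict (M' := InjectiveAction)
    fun X hX => ⟨q.injectiveAction_le X hX, trivial⟩).ofIso e
  let d' := ((nablaLastData h').comp ((f.presentation.inSnd (Vtx n)).derivedData.comp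
    ((g.presentation.inFst (Vtx m)).derivedData.comp
      (exchangeData k (Vtx n) (Vtx m))))).restrict (M' := InjectiveAction) fun X hX =>
        ⟨trivial, ObjectProperty.prop_of_iso _ ((nablaLastIso h').app X)
          (f.presentation.injectiveAction_le_inSnd f.injectiveAction_le _ (hX.pull _)),
          ObjectProperty.prop_of_iso _
            ((inSnd k (Vtx n) (nakayama k (Vtx m))).mapIso ((nablaLastIso h').app X))
            (acyclic_inFst f g (interlaced hl hm hn h h') X hX), trivial⟩
  d.uniq d' injectiveActionResolution injectiveActionResolution

/-- What remains after `derivedNakayamaIso` is to collect shifts: `τ` contributes `-1`, while `τ₁`,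
`τ₂` and the outer shift contribute `-1 - 1 + 1`. -/
lemma nonempty_iso_translation (hm : 1 ≤ m) (hn : 1 ≤ n) (h : l = m + n - 1) (h' : l = n + m - 1)
    {D₁ D₂ X τ τ₁ τ₂}
    (h₁ : IsLeftDerived (nabla k l m 1 n h) D₁)
    (h₂ : IsLeftDerived (nabla k l n n m h') D₂)
    (hX : IsLeftDerived (exchangeFactors k (Vtx n) (Vtx m)) X)
    (hτ : IsTranslation (nakayama k (Vtx l)) τ)
    (hτ₁ : IsTranslation (inFst k (Vtx m) (nakayama k (Vtx n))) τ₁)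
    (hτ₂ : IsTranslation (inSnd k (Vtx n) (nakayama k (Vtx m))) τ₂) :
    Nonempty (τ ⋙ D₁ ≅
      D₂ ⋙ (τ₂ ⋙ τ₁) ⋙ X ⋙ shiftFunctor (Db k (Vtx m × Vtx n)) (1 : ℤ)) := by
  have hl : 1 ≤ l := by omega
  let f := topQuotientNakayama (k := k) hm
  let g := topQuotientNakayama (k := k) hn
  let q := topQuotientNakayama (k := k) hl
  let dl := q.presentation.derivedData
  let dm := (f.presentation.inSnd (Vtx n)).derivedData
  let dn := (g.presentation.inFst (Vtx m)).derivedData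
  let d₁ := nablaFirstData (k := k) h
  let d₂ := nablaLastData (k := k) h'
  let dX := exchangeData k (Vtx n) (Vtx m)
  let rl := injectiveActionResolution.ofLE q.injectiveAction_le
  let rm := injectiveActionResolution.ofLE
    (f.presentation.injectiveAction_le_inSnd (E := Vtx n) f.injectiveAction_le)
  let rn := injectiveActionResolution.ofLE
    (g.presentation.injectiveAction_le_inFst (E := Vtx m) g.injectiveAction_le)
  obtain ⟨e₁⟩ := h₁.nonempty_iso d₁ (resolutionTop _ _)
  obtain ⟨e₂⟩ := h₂.nonempty_iso d₂ (resolutionTop _ _)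
  obtain ⟨eX⟩ := hX.nonempty_iso dX (resolutionTop _ _)
  obtain ⟨eτ⟩ := hτ.nonempty_iso dl rl
  obtain ⟨eτ₁⟩ := hτ₁.nonempty_iso dn rn
  obtain ⟨eτ₂⟩ := hτ₂.nonempty_iso dm rm
  let s {I : Type} [SmallCategory I] : DerivedCategory (Rep k I) ⥤ DerivedCategory (Rep k I) :=
    shiftFunctor _ (-1 : ℤ)
  let t := shiftFunctor (DerivedCategory (Rep k (Vtx m × Vtx n))) (1 : ℤ)
  let ι {I : Type} [SmallCategory I] : Db k I ⥤ DerivedCategory (Rep k I) := Bounded.ι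
  let left : (τ ⋙ D₁) ⋙ ι ≅ ι ⋙ (dl.L ⋙ d₁.L) ⋙ s :=
    Functor.isoWhiskerLeft τ e₁ ≪≫ Functor.isoWhiskerRight eτ d₁.L ≪≫
      Functor.isoWhiskerLeft (ι ⋙ dl.L) (d₁.shiftIso (resolutionTop _ _) (-1))
  let right : (D₂ ⋙ (τ₂ ⋙ τ₁) ⋙ X ⋙ shiftFunctor (Db k (Vtx m × Vtx n)) (1 : ℤ)) ⋙ ι ≅
      ι ⋙ (d₂.L ⋙ dm.L ⋙ dn.L ⋙ dX.L) ⋙ s :=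
    Functor.isoWhiskerLeft (D₂ ⋙ τ₂ ⋙ τ₁ ⋙ X) (Bounded.ι.commShiftIso (1 : ℤ)) ≪≫
    Functor.isoWhiskerLeft (D₂ ⋙ τ₂ ⋙ τ₁) (Functor.isoWhiskerRight eX t) ≪≫
    Functor.isoWhiskerLeft (D₂ ⋙ τ₂) (Functor.isoWhiskerRight eτ₁ (dX.L ⋙ t)) ≪≫
    Functor.isoWhiskerLeft D₂ (Functor.isoWhiskerRight eτ₂ (dn.L ⋙ s ⋙ dX.L ⋙ t)) ≪≫
    Functor.isoWhiskerRight e₂ (dm.L ⋙ s ⋙ dn.L ⋙ s ⋙ dX.L ⋙ t) ≪≫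
    -- Both shifts by `-1` are moved to the right; one cancels against `t`, and the other ends up
    -- last.
    Functor.isoWhiskerLeft (ι ⋙ d₂.L ⋙ dm.L) (
      Functor.isoWhiskerRight (dn.shiftIso rn (-1)) (s ⋙ dX.L ⋙ t) ≪≫
      Functor.isoWhiskerLeft (dn.L ⋙ s)
        (Functor.isoWhiskerRight (dX.shiftIso (resolutionTop _ _) (-1)) t ≪≫
          Functor.isoWhiskerLeft dX.L (shiftFunctorCompIsoId _ (-1 : ℤ) 1 (by simp))) ≪≫
      Functor.isoWhiskerLeft dn.L (dX.shiftIso (resolutionTop _ _) (-1)))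
  -- The comparison takes place in unbounded derived categories, and full faithfulness of
  -- `Bounded.ι` brings it back.
  exact ⟨Functor.fullyFaithfulCancelRight Bounded.ι (left ≪≫
    Functor.isoWhiskerLeft ι (Functor.isoWhiskerRight (derivedNakayamaIso hl hm hn h h') s) ≪≫
    right.symm)⟩

end Translation

end TypeA

theorem mainTheorem3 (k : Type u) [Field k] (l m n : ℕ) (hm : 1 ≤ m) (hn : 1 ≤ n)
    (h : l = m + n - 1) (h' : l = n + m - 1) :
    -- the equality of supports, with the projectivity needed to form the fiber-reversals
    (InjectiveInDirection (sides m n) 0 (supportSet m 1 n) ∧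
      ProjectiveInDirection (sides n m) 2 (supportSet n n m) ∧
      ProjectiveInDirection (sides n m) 1
        (reverseProjective (sides n m) 2 (supportSet n n m)) ∧
      reverseInjective (sides m n) 0 (supportSet m 1 n) =
        swapLast ⁻¹' reverseProjective (sides n m) 1
          (reverseProjective (sides n m) 2 (supportSet n n m))) ∧
    -- the derived functors and Auslander-Reiten translations used below exist
    ((∃ T, IsLeftDerived (inSnd k (Vtx l)ᵒᵖ (nabla k l m 1 n h)) T) ∧
      (∃ T, IsLeftDerived
        (inSnd k (Vtx l)ᵒᵖ (inSnd k (Vtx n) (tensorFunctor (moduleN k m)))) T) ∧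
      (∃ T, IsLeftDerived
        (inSnd k (Vtx l)ᵒᵖ (inFst k (Vtx m) (tensorFunctor (moduleN k n)))) T) ∧
      (∃ T, IsLeftDerived (inSnd k (Vtx l)ᵒᵖ (exchangeFactors k (Vtx n) (Vtx m))) T) ∧
      (∃ D, IsLeftDerived (nabla k l m 1 n h) D) ∧
      (∃ D, IsLeftDerived (nabla k l n n m h') D) ∧
      (∃ X, IsLeftDerived (exchangeFactors k (Vtx n) (Vtx m)) X) ∧
      (∃ τ, IsTranslation (nakayama k (Vtx l)) τ) ∧
      (∃ τ, IsTranslation (inFst k (Vtx m) (nakayama k (Vtx n))) τ) ∧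
      (∃ τ, IsTranslation (inSnd k (Vtx n) (nakayama k (Vtx m))) τ)) ∧
    -- the isomorphism `N_l ⊗ᴸ M_{m;1}^n ≃ (M_{n;n}^m ⊗ᴸ N_m) ⊗ᴸ N_n`, up to the flip
    (∀ T₁ T₂ T₃ T₄,
      IsLeftDerived (inSnd k (Vtx l)ᵒᵖ (nabla k l m 1 n h)) T₁ →
      IsLeftDerived (inSnd k (Vtx l)ᵒᵖ (inSnd k (Vtx n) (tensorFunctor (moduleN k m)))) T₂ →
      IsLeftDerived (inSnd k (Vtx l)ᵒᵖ (inFst k (Vtx m) (tensorFunctor (moduleN k n)))) T₃ →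
      IsLeftDerived (inSnd k (Vtx l)ᵒᵖ (exchangeFactors k (Vtx n) (Vtx m))) T₄ →
      Nonempty (T₁.obj (inDegreeZero (moduleN k l)) ≅
        T₄.obj (T₃.obj (T₂.obj (inDegreeZero (moduleM k l n n m h')))))) ∧
    -- the isomorphism of functors `∇_{m;1}^n τ_l ≃ S X (τ_n × τ_m) ∇_{n;n}^m`
    (∀ D₁ D₂ X τ τ₁ τ₂,
      IsLeftDerived (nabla k l m 1 n h) D₁ →
      IsLeftDerived (nabla k l n n m h') D₂ →
      IsLeftDerived (exchangeFactors k (Vtx n) (Vtx m)) X →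
      IsTranslation (nakayama k (Vtx l)) τ →
      IsTranslation (inFst k (Vtx m) (nakayama k (Vtx n))) τ₁ →
      IsTranslation (inSnd k (Vtx n) (nakayama k (Vtx m))) τ₂ →
      Nonempty (τ ⋙ D₁ ≅
        D₂ ⋙ (τ₂ ⋙ τ₁) ⋙ X ⋙ shiftFunctor (Db k (Vtx m × Vtx n)) (1 : ℤ))) :=
  ⟨⟨injectiveInDirection_supportSet m 1 n, projectiveInDirection_supportSet n n m,
      projectiveInDirection_reverseProjective n m, reverseInjective_supportSet m n⟩,
    exists_derived k l m n hm hn h h',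
    fun _ _ _ _ => nonempty_iso_bimodules hm hn h h',
    fun _ _ _ _ _ _ => nonempty_iso_translation hm hn h h'⟩
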